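/- Let $\mathcal S$ be a finite-dimensional commutative associative real algebra with identity, $\mathcal S_c=\mathbf C\otimes_{\mathbf R}\mathcal S$ its complexification, and $l=\dim_{\mathbf R}\mathcal S$. A map between open subsets of $\mathcal S_c^M$ and $\mathcal S_c^N$ is called $\mathcal S$-holomorphic near a point $P$ if near $P$ it is the sum of a convergent power series $\sum_\alpha c_\alpha (Z-P)^\alpha$ in the $M$ algebraic variables $Z=(Z_1,\dots,Z_M)$ with coefficients $c_\alpha\in\mathcal S_c^N$. Let $Q=\{\operatorname{Im} w=\Phi(z,\bar z,\operatorname{Re} w)\}\subset\mathbf C^n\times\mathbf C^k$ be a model surface: the coordinates carry positive integer weights, and each $\Phi_j$ is a real polynomial without linear terms that is quasi-homogeneous of the weight of $w_j$. Let $Q$ be nondegenerate: the coordinates of $\Phi$ are linearly independent, and no nonzero germ at $0$ of a holomorphic $(1,0)$-field is tangent to $Q$. Let $\mathbf C^n\times\mathbf C^k=\mathbf C^{lN}$ be identified with $\mathcal S_c^N$ by a complex linear isomorphism. Let $\operatorname{aut}Q$ be the real Lie algebra of germs at $0$ of holomorphic vector fields $X=2\operatorname{Re}\big(f(\zeta)\,\partial/\partial\zeta\big)$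 tangent to $Q$, and $\operatorname{aut}_{\mathcal S}Q$ the set of those $X\in\operatorname{aut}Q$ whose coefficient map $f$ is $\mathcal S$-holomorphic near $0$. For $X\in\operatorname{aut}Q$, $\exp X$ denotes the time-one map of the flow of $X$: it is taken on a connected open neighbourhood of $0$, and the flow is taken in a connected open neighbourhood of $0$ to which $X$ extends as a holomorphic field tangent to $Q$. Let $\operatorname{Aut}Q$ be the local group generated by all $\exp X$, $X\in\operatorname{aut}Q$: its elements are biholomorphic maps of connected open neighbourhoods of $0$ onto open sets, and products and inverses are formed whenever they are defined on a connected neighbourhood of $0$. Let $\operatorname{Aut}_{\mathcal S}Q$ be the set of those elements of $\operatorname{Aut}Q$ that are $\mathcal S$-holomorphic near $0$. Then: (a) $\operatorname{aut}_{\mathcal S}Q$ is a Lie subalgebra of the real Lie algebra $\operatorname{aut}Q$. (b) $\operatorname{Aut}_{\mathcal S}Q$ is a subgroup of the local group $\operatorname{Aut}Q$: it contains the identity, and it contains the products and inverses of its elements whenever these are defined. Moreover, the local group generated by all $\exp X$, $X\in\operatorname{aut}_{\mathcal S}Q$, is a subgroup of $\operatorname{Aut}_{\mathcal S}Q$; in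 particular, these maps $\exp X$ are $\mathcal S$-holomorphic. (c) The flow of an ordinary differential equation with an $\mathcal S$-holomorphic right-hand side is $\mathcal S$-holomorphic: if $F$ is an $\mathcal S$-holomorphic map of a neighbourhood of $0$ in $\mathcal S_c^N$ to $\mathcal S_c^N$, then there is a map $\Psi(T,Z)$ with values in $\mathcal S_c^N$, $\mathcal S$-holomorphic near $0$ in the $N+1$ variables $T\in\mathcal S_c$, $Z\in\mathcal S_c^N$, such that $\Psi(0,Z)=Z$ for $Z$ near $0$ and $\frac{d}{ds}\big|_{s=0}\Psi(T+s\cdot 1,Z)=F(\Psi(T,Z))$, $s\in\mathbf C$, for $(T,Z)$ near $0$. -/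

import Mathlib

open scoped TensorProduct Topology

noncomputable section

namespace CRAlg

/-! ### The complexified algebra and power series over it -/

section Algebra

variable (S : Type*) [CommRing S] [Algebra ℝ S] [FiniteDimensional ℝ S]

/-- The complexification `S_c = ℂ ⊗ S` of a finite-dimensional commutative real algebra `S`. -/
def Complexification : Type _ := ℂ ⊗[ℝ] S

instance : CommRing (Complexification S) := inferInstanceAs (CommRing (ℂ ⊗[ℝ] S))

instance : Algebra ℂ (Complexification S) := inferInstanceAs (Algebra ℂ (ℂ ⊗[ℝ] S))

/-- The complex coordinates `S_c ≃ ℂ^l`, `l = dim S`, given by a real basis of `S`. -/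
def Complexification.coords :
    Complexification S ≃ₗ[ℂ] (Fin (Module.finrank ℝ S) → ℂ) :=
  (Algebra.TensorProduct.basis ℂ (Module.finBasis ℝ S)).equivFun

/-- The norm of `S_c` given by these coordinates. As `S_c` has finite dimension, any other norm
gives the same neighbourhoods and the same convergent series. -/
instance : NormedAddCommGroup (Complexification S) :=
  NormedAddCommGroup.induced _ (Fin (Module.finrank ℝ S) → ℂ)
    (Complexification.coords S).toLinearMap (Complexification.coords S).injective

instance : NormedSpace ℂ (Complexification S) :=
  NormedSpace.induced ℂ _ (Fin (Module.finrank ℝ S) → ℂ) (Complexification.coords S).toLinearMap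

variable {S}

/-- Near the point `P`, the map `F : S_c^M → S_c^N` is the sum of a power series
`∑ c_α (Z - P)^α` in `M` algebraic variables with coefficients `c_α` in `S_c^N`. -/
def SAnalyticAt {M N : ℕ} (F : (Fin M → Complexification S) → (Fin N → Complexification S))
    (P : Fin M → Complexification S) : Prop :=
  ∃ c : (Fin M → ℕ) → (Fin N → Complexification S),
    ∀ᶠ H in 𝓝 (0 : Fin M → Complexification S),
      HasSum (fun α : Fin M → ℕ => (∏ i, H i ^ α i) • c α) (F (P + H))

/-- `S`-holomorphy in a neighbourhood of zero. -/
def SHolomorphicNearZero {M N : ℕ}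
    (F : (Fin M → Complexification S) → (Fin N → Complexification S)) : Prop :=
  SAnalyticAt F 0

end Algebra

/-! ### Germs at zero of holomorphic vector fields -/

section Fields

variable (V : Type*) [NormedAddCommGroup V] [NormedSpace ℂ V]

/-- The real vector space of germs at zero of holomorphic maps `V → V`. -/
def holGerms : Submodule ℝ (Filter.Germ (𝓝 (0 : V)) V) where
  carrier := {X | ∃ f : V → V, AnalyticAt ℂ f 0 ∧ X = (f : Filter.Germ (𝓝 (0 : V)) V)}
  add_mem' := by
    rintro _ _ ⟨f, hf, rfl⟩ ⟨g, hg, rfl⟩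
    exact ⟨f + g, hf.add hg, rfl⟩
  zero_mem' := ⟨0, analyticAt_const, rfl⟩
  smul_mem' := by
    rintro c _ ⟨f, hf, rfl⟩
    refine ⟨(fun _ : V => (c : ℂ)) • f, analyticAt_const.smul hf, ?_⟩
    have h : (fun _ : V => (c : ℂ)) • f = c • f := by
      ext x
      exact Complex.coe_smul c (f x)
    rw [h]
    rfl

theorem mem_holGerms {X : Filter.Germ (𝓝 (0 : V)) V} : X ∈ holGerms V ↔
    ∃ f : V → V, AnalyticAt ℂ f 0 ∧ X = (f : Filter.Germ (𝓝 (0 : V)) V) := Iff.rfl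

/-- Germs at zero of holomorphic real vector fields `2 Re (f(ζ) ∂/∂ζ)` on `V`. Such a field is
given by the germ of the holomorphic map `f : V → V`; as a real vector field on `V` it has the
value `f(p)` at `p`. -/
def HolField : Type _ := holGerms V

instance : AddCommGroup (HolField V) := inferInstanceAs (AddCommGroup (holGerms V))

instance : Module ℝ (HolField V) := inferInstanceAs (Module ℝ (holGerms V))

variable {V}

/-- The germ of a holomorphic vector field. -/
def HolField.mk (f : V → V) (hf : AnalyticAt ℂ f 0) : HolField V :=
  (⟨(f : Filter.Germ (𝓝 (0 : V)) V), (mem_holGerms V).2 ⟨f, hf, rfl⟩⟩ : holGerms V)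

/-- A chosen representative of a germ. -/
def HolField.rep (X : HolField V) : V → V := ((mem_holGerms V).1 X.2).choose

theorem HolField.analyticAt_rep (X : HolField V) : AnalyticAt ℂ X.rep 0 :=
  ((mem_holGerms V).1 X.2).choose_spec.1

theorem HolField.mk_rep (X : HolField V) : HolField.mk X.rep X.analyticAt_rep = X :=
  Subtype.ext ((mem_holGerms V).1 X.2).choose_spec.2.symm

theorem HolField.mk_eq_mk {f g : V → V} {hf : AnalyticAt ℂ f 0} {hg : AnalyticAt ℂ g 0} :
    HolField.mk f hf = HolField.mk g hg ↔ f =ᶠ[𝓝 0] g :=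
  Subtype.ext_iff.trans Filter.Germ.coe_eq

theorem HolField.rep_mk {f : V → V} (hf : AnalyticAt ℂ f 0) :
    (HolField.mk f hf).rep =ᶠ[𝓝 0] f :=
  HolField.mk_eq_mk.1 (HolField.mk_rep (HolField.mk f hf))

theorem HolField.mk_add_mk {f g : V → V} (hf : AnalyticAt ℂ f 0) (hg : AnalyticAt ℂ g 0) :
    HolField.mk f hf + HolField.mk g hg = HolField.mk (f + g) (hf.add hg) := rfl

theorem HolField.smul_mk (c : ℝ) {f : V → V} (hf : AnalyticAt ℂ f 0) :
    c • HolField.mk f hf =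
      HolField.mk ((fun _ : V => (c : ℂ)) • f) (analyticAt_const.smul hf) := by
  have h : (fun _ : V => (c : ℂ)) • f = c • f := by
    ext x
    exact Complex.coe_smul c (f x)
  refine Subtype.ext ?_
  change ((c • f : V → V) : Filter.Germ (𝓝 (0 : V)) V) =
    (((fun _ : V => (c : ℂ)) • f : V → V) : Filter.Germ (𝓝 (0 : V)) V)
  rw [h]

theorem HolField.ind {p : HolField V → Prop} (h : ∀ f hf, p (HolField.mk f hf))
    (X : HolField V) : p X :=
  X.mk_rep ▸ h _ _

variable [CompleteSpace V]

theorem analyticAt_lieBracket {f g : V → V} (hf : AnalyticAt ℂ f 0) (hg : AnalyticAt ℂ g 0) :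
    AnalyticAt ℂ (VectorField.lieBracket ℂ f g) 0 :=
  (((ContinuousLinearMap.id ℂ (V →L[ℂ] V)).analyticAt_bilinear (fderiv ℂ g 0, f 0)).comp₂
    hg.fderiv hf).sub
  (((ContinuousLinearMap.id ℂ (V →L[ℂ] V)).analyticAt_bilinear (fderiv ℂ f 0, g 0)).comp₂
    hf.fderiv hg)

/-- The commutator of vector fields: `[X, Y] = DY(X) - DX(Y)`. -/
instance : Bracket (HolField V) (HolField V) where
  bracket X Y := HolField.mk (VectorField.lieBracket ℂ X.rep Y.rep)
    (analyticAt_lieBracket X.analyticAt_rep Y.analyticAt_rep)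

theorem HolField.mk_lie_mk {f g : V → V} (hf : AnalyticAt ℂ f 0) (hg : AnalyticAt ℂ g 0) :
    ⁅HolField.mk f hf, HolField.mk g hg⁆ =
      HolField.mk (VectorField.lieBracket ℂ f g) (analyticAt_lieBracket hf hg) :=
  HolField.mk_eq_mk.2 ((HolField.rep_mk hf).lieBracket_vectorField (HolField.rep_mk hg))

instance : LieRing (HolField V) where
  add_lie X Y Z := by
    induction X using HolField.ind with | h f hf
    induction Y using HolField.ind with | h g hg
    induction Z using HolField.ind with | h k hk
    simp only [HolField.mk_lie_mk, HolField.mk_add_mk]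
    refine HolField.mk_eq_mk.2 ?_
    filter_upwards [hf.eventually_analyticAt, hg.eventually_analyticAt] with x h1 h2
    exact VectorField.lieBracket_add_left h1.differentiableAt h2.differentiableAt
  lie_add X Y Z := by
    induction X using HolField.ind with | h f hf
    induction Y using HolField.ind with | h g hg
    induction Z using HolField.ind with | h k hk
    simp only [HolField.mk_lie_mk, HolField.mk_add_mk]
    refine HolField.mk_eq_mk.2 ?_
    filter_upwards [hg.eventually_analyticAt, hk.eventually_analyticAt] with x h1 h2
    exact VectorField.lieBracket_add_right h1.differentiableAt h2.differentiableAt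
  lie_self X := by
    induction X using HolField.ind with | h f hf
    rw [HolField.mk_lie_mk]
    have h0 : AnalyticAt ℂ (0 : V → V) 0 := analyticAt_const
    have h : HolField.mk (0 : V → V) h0 = 0 := rfl
    rw [← h, HolField.mk_eq_mk, VectorField.lieBracket_self]
  leibniz_lie X Y Z := by
    induction X using HolField.ind with | h f hf
    induction Y using HolField.ind with | h g hg
    induction Z using HolField.ind with | h k hk
    simp only [HolField.mk_lie_mk, HolField.mk_add_mk]
    refine HolField.mk_eq_mk.2 ?_
    filter_upwards [hf.eventually_analyticAt, hg.eventually_analyticAt,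
      hk.eventually_analyticAt] with x h1 h2 h3
    exact VectorField.leibniz_identity_lieBracket (n := 2) (by simp)
      h1.contDiffAt h2.contDiffAt h3.contDiffAt

instance : LieAlgebra ℝ (HolField V) where
  lie_smul c X Y := by
    induction X using HolField.ind with | h f hf
    induction Y using HolField.ind with | h g hg
    simp only [HolField.smul_mk, HolField.mk_lie_mk]
    refine HolField.mk_eq_mk.2 ?_
    filter_upwards [hg.eventually_analyticAt] with x h1
    exact VectorField.lieBracket_const_smul_right h1.differentiableAt

end Fields

/-! ### Local groups of holomorphic transformations -/

section Groups

variable {V : Type*} [NormedAddCommGroup V] [NormedSpace ℂ V]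

/-- A biholomorphic map of a connected open neighbourhood of zero (its source) onto an open set
(its target). It need not fix zero. -/
structure IsLocalBihol (e : OpenPartialHomeomorph V V) : Prop where
  zero_mem : (0 : V) ∈ e.source
  connected : IsConnected e.source
  holo : AnalyticOnNhd ℂ e e.source
  holo_symm : AnalyticOnNhd ℂ e.symm e.target

/-- `g` is the product `e₂ ∘ e₁` on a connected neighbourhood of zero on which this composition
is defined. -/
structure IsLocalProduct (e₁ e₂ g : OpenPartialHomeomorph V V) : Prop where
  zero_mem : (0 : V) ∈ g.source
  connected : IsConnected g.source
  subset : g.source ⊆ (e₁.trans e₂).source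
  eqOn : Set.EqOn g (e₂ ∘ e₁) g.source

/-- The local group generated by a set of local transformations: all maps obtained from them by
products and inverses, wherever these are defined near zero. -/
inductive LocalGroupGen (G : Set (OpenPartialHomeomorph V V)) :
    OpenPartialHomeomorph V V → Prop
  | of (e : OpenPartialHomeomorph V V) (he : e ∈ G) : LocalGroupGen G e
  | mul (e₁ e₂ g : OpenPartialHomeomorph V V) (h₁ : LocalGroupGen G e₁)
      (h₂ : LocalGroupGen G e₂) (h : IsLocalProduct e₁ e₂ g) : LocalGroupGen G g
  | inv (e : OpenPartialHomeomorph V V) (he : LocalGroupGen G e) (h : (0 : V) ∈ e.target) :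
      LocalGroupGen G e.symm

/-- `H` is a subgroup of the local group `G`: it contains the identity, and products and
inverses of its elements belong to it whenever they are defined near zero. -/
structure IsLocalSubgroup (H G : Set (OpenPartialHomeomorph V V)) : Prop where
  subset : H ⊆ G
  one_mem : OpenPartialHomeomorph.refl V ∈ H
  mul_mem : ∀ e₁ ∈ H, ∀ e₂ ∈ H, ∀ g, IsLocalProduct e₁ e₂ g → g ∈ H
  inv_mem : ∀ e ∈ H, (0 : V) ∈ e.target → e.symm ∈ H

end Groups

/-! ### Model surfaces -/

/-- The space `ℂ^n × ℂ^k` with coordinates `(z, w)`. -/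
abbrev Ambient (n k : ℕ) : Type := (Fin n → ℂ) × (Fin k → ℂ)

/-- The variables of the right-hand side of `Im w = Φ(z, z̄, Re w)`: `Re z_i`, `Im z_i`,
`Re w_j`. -/
abbrev Var (n k : ℕ) : Type := (Fin n ⊕ Fin n) ⊕ Fin k

/-- The values of these variables at a point. -/
def varValue {n k : ℕ} (p : Ambient n k) : Var n k → ℝ :=
  Sum.elim (Sum.elim (fun i => (p.1 i).re) (fun i => (p.1 i).im)) (fun j => (p.2 j).re)

/-- The data of a (weighted) model surface `Im w = Φ(z, z̄, Re w)` of CR-type `(n, k)`: positive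
integer weights of the coordinates, and real polynomials `Φ_j` that are quasi-homogeneous of the
weight of `w_j` and have no linear terms. The last condition says that the tangent space at zero
is `Im w = 0`, so that its complex part, the complex tangent space, is `w = 0`. -/
structure ModelSurface (n k : ℕ) where
  wtz : Fin n → ℕ
  wtw : Fin k → ℕ
  wtz_pos : ∀ i, 0 < wtz i
  wtw_pos : ∀ j, 0 < wtw j
  Φ : Fin k → MvPolynomial (Var n k) ℝ
  homogeneous : ∀ j,
    (Φ j).IsWeightedHomogeneous (Sum.elim (Sum.elim wtz wtz) wtw) (wtw j)
  no_linear : ∀ j s, (Φ j).coeff (Finsupp.single s 1) = 0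

namespace ModelSurface

variable {n k : ℕ} (Q : ModelSurface n k)

/-- The defining functions `Im w_j - Φ_j(z, z̄, Re w)`. -/
def defFun (j : Fin k) (p : Ambient n k) : ℝ :=
  (p.2 j).im - MvPolynomial.eval (varValue p) (Q.Φ j)

/-- The surface as a subset of `ℂ^n × ℂ^k`. -/
def carrier : Set (Ambient n k) := {p | ∀ j, Q.defFun j p = 0}

/-- The (real) tangent space at a point of the surface. -/
def tangent (p : Ambient n k) : Set (Ambient n k) :=
  {v | ∀ j, fderiv ℝ (Q.defFun j) p v = 0}

/-- The field with coefficients `f` is tangent to the surface at all points of `U` on it. -/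
def TangentOn (f : Ambient n k → Ambient n k) (U : Set (Ambient n k)) : Prop :=
  ∀ p ∈ U, p ∈ Q.carrier → f p ∈ Q.tangent p

/-- No nonzero germ at zero of a holomorphic `(1,0)`-field `f(ζ) ∂/∂ζ` is tangent to the surface;
tangency of this complex field means that the real vectors `f(p)` and `i f(p)` are both
tangent. -/
def HolomorphicallyNondegenerate : Prop :=
  ∀ f : Ambient n k → Ambient n k, AnalyticAt ℂ f 0 →
    (∃ U ∈ 𝓝 (0 : Ambient n k), Q.TangentOn f U ∧ Q.TangentOn (fun p => Complex.I • f p) U) →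
    f =ᶠ[𝓝 0] 0

/-- Nondegeneracy: the coordinates of `Φ` are linearly independent, and the surface is
holomorphically nondegenerate. -/
structure Nondegenerate : Prop where
  linearIndependent : LinearIndependent ℝ Q.Φ
  holomorphicallyNondegenerate : Q.HolomorphicallyNondegenerate

/-- `aut Q`: the germs at zero of holomorphic vector fields tangent to `Q`. -/
def aut : Set (HolField (Ambient n k)) :=
  {X | ∃ f : Ambient n k → Ambient n k, ∃ hf : AnalyticAt ℂ f 0, X = HolField.mk f hf ∧
    ∃ U ∈ 𝓝 (0 : Ambient n k), Q.TangentOn f U}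

/-- `e = exp X`: the germ `X` extends to a holomorphic field `f` tangent to `Q` on a connected
open neighbourhood `U` of zero, and `e` is a biholomorphic map of a connected neighbourhood of
zero that takes each `p` to the value at time `1` of the solution of `dζ/dt = f(ζ)` in `U` with
`ζ(0) = p`. -/
def IsExp (X : HolField (Ambient n k))
    (e : OpenPartialHomeomorph (Ambient n k) (Ambient n k)) : Prop :=
  IsLocalBihol e ∧
  ∃ (U : Set (Ambient n k)) (f : Ambient n k → Ambient n k) (hf : AnalyticAt ℂ f 0),
    IsOpen U ∧ IsConnected U ∧ 0 ∈ U ∧ AnalyticOnNhd ℂ f U ∧ Q.TangentOn f U ∧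
    X = HolField.mk f hf ∧
    ∀ p ∈ e.source, ∃ γ : ℝ → Ambient n k, γ 0 = p ∧ γ 1 = e p ∧
      ∀ t ∈ Set.Icc (0 : ℝ) 1, γ t ∈ U ∧ HasDerivWithinAt γ (f (γ t)) (Set.Icc 0 1) t

/-- The local group generated by the maps `exp X` for `X` in a set `A` of fields. -/
def expGroup (A : Set (HolField (Ambient n k))) :
    Set (OpenPartialHomeomorph (Ambient n k) (Ambient n k)) :=
  {e | LocalGroupGen {g | ∃ X ∈ A, Q.IsExp X g} e}

/-- `Aut Q`: the local group of holomorphic automorphisms of `Q` generated by `aut Q`. -/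
def Aut : Set (OpenPartialHomeomorph (Ambient n k) (Ambient n k)) := Q.expGroup Q.aut

end ModelSurface

/-! ### `S`-holomorphic fields and automorphisms -/

section SHol

variable {S : Type*} [CommRing S] [Algebra ℝ S] [FiniteDimensional ℝ S] {n k N : ℕ}

/-- `S`-holomorphy in a neighbourhood of zero of a map of `ℂ^n × ℂ^k` to itself, when this space
is identified with `S_c^N` by `ψ`. -/
def SHol (ψ : Ambient n k ≃ₗ[ℂ] (Fin N → Complexification S))
    (f : Ambient n k → Ambient n k) : Prop :=
  SHolomorphicNearZero (fun Z => ψ (f (ψ.symm Z)))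

/-- `aut_S Q`: the fields of `aut Q` whose coefficients are `S`-holomorphic near zero. -/
def ModelSurface.autS (Q : ModelSurface n k)
    (ψ : Ambient n k ≃ₗ[ℂ] (Fin N → Complexification S)) : Set (HolField (Ambient n k)) :=
  {X | X ∈ Q.aut ∧
    ∃ f : Ambient n k → Ambient n k, ∃ hf : AnalyticAt ℂ f 0, X = HolField.mk f hf ∧ SHol ψ f}

/-- `Aut_S Q`: the elements of `Aut Q` that are `S`-holomorphic near zero. -/
def ModelSurface.AutS (Q : ModelSurface n k)
    (ψ : Ambient n k ≃ₗ[ℂ] (Fin N → Complexification S)) :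
    Set (OpenPartialHomeomorph (Ambient n k) (Ambient n k)) :=
  {e | e ∈ Q.Aut ∧ SHol ψ e}

end SHol

end CRAlg

end

/-!
A map between powers of `S_c` is `S`-holomorphic if and only if it is analytic and its derivatives
commute with the multiplications by the elements of `S_c`. In the latter form the property
passes to sums, compositions, inverses and Lie brackets, and it spreads over connected
open sets by analytic continuation. It passes to the time-one map of a field that has it: if `A` is
a multiplication and `ζ_y` the solution with the initial value `y`, then `ζ_x + A (ζ_y - ζ_x)`
solves the equation up to an error quadratic in `y - x`, so by Gronwall's inequality it is that
close to the solution with the initial value `x + A (y - x)`.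

For a time `T` in the algebra, the suspended field `(T, Z) ↦ (0, T F(Z))` is solved on the real
interval `[0, 1]` by inverting the analytic map `u ↦ u - ∫ f(u)` on continuous curves. It is
invertible because the linear part of the suspended field at zero is nilpotent, and the solution
`(T, ζ)` inherits the `S`-holomorphy. Since `F` is `S`-holomorphic, `t F(ζ(t))` solves the
variational equation in the direction of `T`, and at `t = 1` this is `∂Ψ/∂T = F(Ψ)`.
-/

noncomputable section

namespace CRAlg

/-! ### Maps whose derivatives intertwine two operators -/

section Intertwining

variable {𝕜 E F G : Type*} [NontriviallyNormedField 𝕜] [NormedAddCommGroup E] [NormedSpace 𝕜 E]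
  [NormedAddCommGroup F] [NormedSpace 𝕜 F] [NormedAddCommGroup G] [NormedSpace 𝕜 G]

theorem fderiv_apply_fderiv_symm {e : OpenPartialHomeomorph E F} {y : F} (hy : y ∈ e.target)
    (he : DifferentiableAt 𝕜 e (e.symm y)) (hs : DifferentiableAt 𝕜 e.symm y) (v : F) :
    fderiv 𝕜 e (e.symm y) (fderiv 𝕜 e.symm y v) = v := by
  have h := (he.hasFDerivAt.comp y hs.hasFDerivAt).unique
    ((hasFDerivAt_id y).congr_of_eventuallyEq (e.eventually_right_inverse hy))
  exact DFunLike.congr_fun h v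

theorem fderiv_symm_apply_fderiv {e : OpenPartialHomeomorph E F} {y : F} (hy : y ∈ e.target)
    (he : DifferentiableAt 𝕜 e (e.symm y)) (hs : DifferentiableAt 𝕜 e.symm y) (v : E) :
    fderiv 𝕜 e.symm y (fderiv 𝕜 e (e.symm y) v) = v := by
  have := fderiv_apply_fderiv_symm (e := e.symm) (y := e.symm y) (e.map_target hy)
    (by rwa [e.symm_symm, e.right_inv hy]) (by rwa [e.symm_symm]) v
  rwa [e.symm_symm, e.right_inv hy] at this

/-- `f` is analytic at `x`, and near `x` its derivatives intertwine the operators `A` and `B`. If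
`A` and `B` run through the multiplications by the elements of an algebra, this says that the
derivatives are linear over that algebra. -/
structure IntertwinesAt (A : E →L[𝕜] E) (B : F →L[𝕜] F) (f : E → F) (x : E) : Prop where
  analyticAt : AnalyticAt 𝕜 f x
  comm : ∀ᶠ y in 𝓝 x, ∀ h, fderiv 𝕜 f y (A h) = B (fderiv 𝕜 f y h)

namespace IntertwinesAt

variable {A : E →L[𝕜] E} {B : F →L[𝕜] F} {C : G →L[𝕜] G} {x : E}

theorem self_comm {f : E → F} (hf : IntertwinesAt A B f x) (h : E) :
    fderiv 𝕜 f x (A h) = B (fderiv 𝕜 f x h) :=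
  hf.comm.self_of_nhds h

theorem congr {f g : E → F} (hf : IntertwinesAt A B f x) (hfg : f =ᶠ[𝓝 x] g) :
    IntertwinesAt A B g x := by
  refine ⟨hf.analyticAt.congr hfg, ?_⟩
  filter_upwards [hf.comm, hfg.eventuallyEq_nhds] with y hy hfgy h
  rw [← hfgy.fderiv_eq, hy]

theorem of_clm (L : E →L[𝕜] F) (hL : ∀ h, L (A h) = B (L h)) (x : E) : IntertwinesAt A B L x :=
  ⟨L.analyticAt x, .of_forall fun y h => by rw [L.fderiv, hL]⟩

theorem id (x : E) : IntertwinesAt A A (fun y : E => y) x :=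
  of_clm (A := A) (B := A) (.id 𝕜 E) (fun _ => rfl) x

theorem const (c : F) (x : E) : IntertwinesAt A B (fun _ => c) x :=
  ⟨analyticAt_const, .of_forall fun y h => by simp⟩

section CompleteCodomain

variable [CompleteSpace F]

theorem eventually {f : E → F} (hf : IntertwinesAt A B f x) :
    ∀ᶠ y in 𝓝 x, IntertwinesAt A B f y := by
  filter_upwards [hf.analyticAt.eventually_analyticAt, hf.comm.eventually_nhds] with y ha hc
  exact ⟨ha, hc⟩

theorem add {f g : E → F} (hf : IntertwinesAt A B f x) (hg : IntertwinesAt A B g x) :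
    IntertwinesAt A B (fun y => f y + g y) x := by
  refine ⟨hf.analyticAt.add hg.analyticAt, ?_⟩
  filter_upwards [hf.eventually, hg.eventually] with y hfy hgy h
  rw [fderiv_fun_add hfy.analyticAt.differentiableAt hgy.analyticAt.differentiableAt]
  simp only [add_apply, hfy.self_comm, hgy.self_comm, map_add]

theorem comp [CompleteSpace G] {g : F → G} {f : E → F} (hg : IntertwinesAt B C g (f x))
    (hf : IntertwinesAt A B f x) : IntertwinesAt A C (fun y => g (f y)) x := by
  refine ⟨hg.analyticAt.comp hf.analyticAt, ?_⟩
  filter_upwards [hf.eventually, hf.analyticAt.continuousAt.eventually hg.eventually]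
    with y hfy hgy h
  rw [fderiv_fun_comp y hgy.analyticAt.differentiableAt hfy.analyticAt.differentiableAt]
  simp only [ContinuousLinearMap.comp_apply, hfy.self_comm, hgy.self_comm]

theorem clm_comp [CompleteSpace G] (L : F →L[𝕜] G) (hL : ∀ h, L (B h) = C (L h)) {f : E → F}
    (hf : IntertwinesAt A B f x) : IntertwinesAt A C (fun y => L (f y)) x :=
  (of_clm L hL (f x)).comp hf

theorem sub {f g : E → F} (hf : IntertwinesAt A B f x) (hg : IntertwinesAt A B g x) :
    IntertwinesAt A B (fun y => f y - g y) x := by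
  refine ⟨hf.analyticAt.sub hg.analyticAt, ?_⟩
  filter_upwards [hf.eventually, hg.eventually] with y hfy hgy h
  rw [fderiv_fun_sub hfy.analyticAt.differentiableAt hgy.analyticAt.differentiableAt]
  simp only [sub_apply, hfy.self_comm, hgy.self_comm, map_sub]

theorem symm [CompleteSpace E] {e : OpenPartialHomeomorph E F} {y : F} (hy : y ∈ e.target)
    (he : IntertwinesAt A B e (e.symm y)) (hs : AnalyticAt 𝕜 e.symm y) :
    IntertwinesAt B A e.symm y := by
  refine ⟨hs, ?_⟩
  filter_upwards [e.open_target.mem_nhds hy, hs.eventually_analyticAt,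
    hs.continuousAt.eventually he.eventually] with z hz hsz hez v
  have hed := hez.analyticAt.differentiableAt
  conv_lhs => rw [← fderiv_apply_fderiv_symm hz hed hsz.differentiableAt v, ← hez.self_comm,
    fderiv_symm_apply_fderiv hz hed hsz.differentiableAt]

theorem fderiv_fderiv_comm {f : E → F} (hf : IntertwinesAt A B f x) (u v : E) :
    fderiv 𝕜 (fderiv 𝕜 f) x u (A v) = B (fderiv 𝕜 (fderiv 𝕜 f) x u v) := by
  have hd := hf.analyticAt.fderiv.differentiableAt.hasFDerivAt
  have hA := hd.clm_apply (hasFDerivAt_const (A v) x)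
  have hB := B.hasFDerivAt.comp x (hd.clm_apply (hasFDerivAt_const v x))
  have h := hA.unique (hB.congr_of_eventuallyEq (hf.comm.mono fun y hy => hy v))
  simpa using DFunLike.congr_fun h u

theorem fderiv_apply {g : E → F} {f : E → E} [CompleteSpace E] (hg : IntertwinesAt A B g x)
    (hf : IntertwinesAt A A f x) : IntertwinesAt A B (fun y => fderiv 𝕜 g y (f y)) x := by
  refine ⟨((ContinuousLinearMap.id 𝕜 (E →L[𝕜] F)).analyticAt_bilinear _).comp₂
    hg.analyticAt.fderiv hf.analyticAt, ?_⟩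
  filter_upwards [hf.eventually, hg.eventually] with y hfy hgy h
  have hsymm (u v : E) : fderiv 𝕜 (fderiv 𝕜 g) y u v = fderiv 𝕜 (fderiv 𝕜 g) y v u :=
    (hgy.analyticAt.contDiffAt (n := minSmoothness 𝕜 2)).isSymmSndFDerivAt le_rfl u v
  rw [(hgy.analyticAt.fderiv.differentiableAt.hasFDerivAt.clm_apply
    hfy.analyticAt.differentiableAt.hasFDerivAt).fderiv]
  simp only [add_apply, ContinuousLinearMap.comp_apply, ContinuousLinearMap.flip_apply, map_add,
    hfy.self_comm, hgy.self_comm, hsymm _ (f y), hgy.fderiv_fderiv_comm]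

theorem of_isPreconnected {f : E → F} {U : Set E} (hf : AnalyticOnNhd 𝕜 f U)
    (hU : IsPreconnected U) (hUo : IsOpen U) {x₀ : E} (hx₀ : x₀ ∈ U)
    (h₀ : IntertwinesAt A B f x₀) (hx : x ∈ U) : IntertwinesAt A B f x := by
  refine ⟨hf x hx, ?_⟩
  filter_upwards [hUo.mem_nhds hx] with y hy h
  have hA : AnalyticOnNhd 𝕜 (fun y => fderiv 𝕜 f y (A h)) U := fun z hz =>
    ((ContinuousLinearMap.apply 𝕜 F (A h)).analyticAt _).comp (hf z hz).fderiv
  have hB : AnalyticOnNhd 𝕜 (fun y => B (fderiv 𝕜 f y h)) U := fun z hz =>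
    (B.analyticAt _).comp (((ContinuousLinearMap.apply 𝕜 F h).analyticAt _).comp (hf z hz).fderiv)
  exact hA.eqOn_of_preconnected_of_eventuallyEq hB hU hx₀ (h₀.comm.mono fun y hy => hy h) hy

end CompleteCodomain

theorem lieBracket [CompleteSpace E] {f g : E → E} (hf : IntertwinesAt A A f x)
    (hg : IntertwinesAt A A g x) : IntertwinesAt A A (VectorField.lieBracket 𝕜 f g) x :=
  (hg.fderiv_apply hf).sub (hf.fderiv_apply hg)

theorem iteratedFDeriv_comm [CompleteSpace E] [CompleteSpace F] {f : E → F}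
    (hf : IntertwinesAt A B f x) (n : ℕ) (v : Fin n → E) (i : Fin n) :
    iteratedFDeriv 𝕜 n f x (Function.update v i (A (v i))) = B (iteratedFDeriv 𝕜 n f x v) := by
  induction n generalizing f with
  | zero => exact i.elim0
  | succ n ih =>
    have hsplit (w : Fin (n + 1) → E) : iteratedFDeriv 𝕜 (n + 1) f x w =
        iteratedFDeriv 𝕜 n (fun y => fderiv 𝕜 f y (w (Fin.last n))) x (Fin.init w) := by
      rw [iteratedFDeriv_succ_apply_right]
      have := (ContinuousLinearMap.apply 𝕜 F (w (Fin.last n))).iteratedFDeriv_comp_left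
        (hf.analyticAt.fderiv.contDiffAt (n := n)) le_rfl
      exact (DFunLike.congr_fun this (Fin.init w)).symm
    induction i using Fin.lastCases with
    | cast j =>
      rw [hsplit, hsplit, Function.update_of_ne (Fin.castSucc_ne_last j).symm,
        Fin.init_update_castSucc]
      exact ih (hf.fderiv_apply (.const _ x)) (Fin.init v) j
    | last =>
      rw [hsplit, hsplit, Function.update_self, Fin.init_update_last]
      have hcomm : (fun y => fderiv 𝕜 f y (A (v (Fin.last n)))) =ᶠ[𝓝 x]
          B ∘ fun y => fderiv 𝕜 f y (v (Fin.last n)) := hf.comm.mono fun y hy => hy _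
      rw [(Filter.EventuallyEq.iteratedFDeriv 𝕜 hcomm n).eq_of_nhds, B.iteratedFDeriv_comp_left
        (hf.fderiv_apply (.const _ x)).analyticAt.contDiffAt le_rfl]
      rfl

end IntertwinesAt

end Intertwining

/-! ### Power series with intertwining terms -/

section IntertwiningSeries

section

variable {𝕜 E F : Type*} [NontriviallyNormedField 𝕜] [NormedAddCommGroup E] [NormedSpace 𝕜 E]
  [NormedAddCommGroup F] [NormedSpace 𝕜 F] {A : E →L[𝕜] E} {B : F →L[𝕜] F}
  {p : FormalMultilinearSeries 𝕜 E F}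

theorem derivSeries_comm (n : ℕ)
    (hp : ∀ (v : Fin (1 + n) → E) i, p (1 + n) (Function.update v i (A (v i))) = B (p (1 + n) v))
    (y v : E) : p.derivSeries n (fun _ => y) (A v) = B (p.derivSeries n (fun _ => y) v) := by
  have hterm (u : E) : p.derivSeries n (fun _ => y) u =
      ∑ s : {s : Finset (Fin (1 + n)) // s.card = n},
        p (1 + n) (s.1.piecewise (fun _ => y) fun _ => u) := by
    simp only [FormalMultilinearSeries.derivSeries, FormalMultilinearSeries.changeOriginSeries,
      ContinuousLinearMap.compFormalMultilinearSeries_apply,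
      ContinuousLinearMap.compContinuousMultilinearMap_coe, ContinuousLinearEquiv.coe_coe,
      LinearIsometryEquiv.coe_coe, Function.comp_apply, map_sum, sum_apply,
      continuousMultilinearCurryFin1_apply, Fin.snoc_zero]
    refine Finset.sum_congr rfl fun s _ => ?_
    exact p.changeOriginSeriesTerm_apply 1 n s s.2 y u
  rw [hterm, hterm, map_sum]
  refine Finset.sum_congr rfl fun ⟨s, hs⟩ _ => ?_
  obtain ⟨i, hi⟩ : ∃ i, sᶜ = {i} := Finset.card_eq_one.1 (by simp [Finset.card_compl, hs])
  rw [← hp _ i]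
  congr 1
  ext j
  have hj : j ∈ s ↔ j ≠ i := by
    rw [← Finset.notMem_compl, hi, Finset.mem_singleton]
  by_cases h : j = i
  · subst h
    simp [hj]
  · simp [hj, h]

theorem IntertwinesAt.of_hasFPowerSeriesAt [CompleteSpace F] {f : E → F} {x : E}
    (hf : HasFPowerSeriesAt f p x)
    (hp : ∀ m (v : Fin m → E) i, p m (Function.update v i (A (v i))) = B (p m v)) :
    IntertwinesAt A B f x := by
  obtain ⟨r, hr⟩ := hf
  refine ⟨hr.analyticAt, ?_⟩
  filter_upwards [Metric.eball_mem_nhds x hr.r_pos] with y hy v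
  have hderiv := hr.fderiv.hasSum_sub hy
  have hsum (u : E) : HasSum (fun n => p.derivSeries n (fun _ => y - x) u) (fderiv 𝕜 f y u) :=
    hderiv.mapL (ContinuousLinearMap.apply 𝕜 F u)
  have hB := B.hasSum (hsum v)
  simp only [← derivSeries_comm _ (hp _)] at hB
  exact (hsum (A v)).unique hB

end

open Nat in
theorem hasFPowerSeriesAt_iteratedFDeriv {𝕜 E F : Type*} [RCLike 𝕜] [NormedAddCommGroup E]
    [NormedSpace 𝕜 E] [NormedAddCommGroup F] [NormedSpace 𝕜 F] [CompleteSpace F] {f : E → F}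
    {x : E} (hf : AnalyticAt 𝕜 f x) :
    HasFPowerSeriesAt f (fun m => (m ! : 𝕜)⁻¹ • iteratedFDeriv 𝕜 m f x) x := by
  obtain ⟨p, r, hp⟩ := hf
  have hfact (m : ℕ) : (m ! : 𝕜) ≠ 0 := Nat.cast_ne_zero.2 m.factorial_ne_zero
  have hnorm (m : ℕ) : ‖(m ! : 𝕜)⁻¹ • iteratedFDeriv 𝕜 m f x‖ ≤ ‖p m‖ := by
    rw [norm_smul, norm_inv, RCLike.norm_natCast, inv_mul_le_iff₀ (by positivity)]
    refine ContinuousMultilinearMap.opNorm_le_bound (by positivity) fun v => ?_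
    rw [hp.iteratedFDeriv_eq_sum_of_completeSpace]
    refine (norm_sum_le_of_le _ fun σ _ => (p m).le_opNorm _).trans_eq ?_
    have hσ (σ : Equiv.Perm (Fin m)) : ∏ i, ‖v (σ i)‖ = ∏ i, ‖v i‖ :=
      Equiv.prod_comp σ fun i => ‖v i‖
    simp [hσ, Finset.card_univ, Fintype.card_perm, mul_assoc]
  refine ⟨r, hp.r_le.trans (FormalMultilinearSeries.radius_le_of_le hnorm), hp.r_pos,
    fun {y} hy => (hp.hasSum hy).congr_fun fun m => ?_⟩
  rw [smul_apply, ← hp.factorial_smul y m, ← Nat.cast_smul_eq_nsmul 𝕜,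
    inv_smul_smul₀ (hfact m)]

end IntertwiningSeries

/-! ### Power series over the algebra and linearity of the derivative -/

section PowerSeries

variable {S : Type*} [CommRing S] [Algebra ℝ S] [FiniteDimensional ℝ S] {M N : ℕ}

instance : FiniteDimensional ℂ (Complexification S) :=
  (Complexification.coords S).symm.finiteDimensional

/-- The action of the algebra on a free module over it as a bounded bilinear map; `smulCLM N a` is
the multiplication by `a`. -/
def smulCLM (N : ℕ) :
    Complexification S →L[ℂ] (Fin N → Complexification S) →L[ℂ] (Fin N → Complexification S) :=
  (Algebra.lsmul ℂ ℂ (Fin N → Complexification S)).toLinearMap.toContinuousBilinearMap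

@[simp]
theorem smulCLM_apply (a : Complexification S) (v : Fin N → Complexification S) :
    smulCLM N a v = a • v := rfl

instance : ContinuousMul (Complexification S) :=
  ⟨(LinearMap.mul ℂ (Complexification S)).toContinuousBilinearMap.continuous₂⟩

theorem norm_prod_smul_le {m : ℕ} (x : Fin m → Complexification S)
    (c : Fin N → Complexification S) :
    ‖(∏ j, x j) • c‖ ≤ ‖smulCLM (S := S) N‖ ^ m * (∏ j, ‖x j‖) * ‖c‖ := by
  induction m with
  | zero => simp
  | succ m ih =>
    rw [Fin.prod_univ_succ, Fin.prod_univ_succ, mul_smul]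
    calc ‖x 0 • (∏ j, x (Fin.succ j)) • c‖
        ≤ ‖smulCLM (S := S) N‖ * ‖x 0‖ * ‖(∏ j, x (Fin.succ j)) • c‖ :=
          (smulCLM N).le_opNorm₂ (x 0) _
      _ ≤ ‖smulCLM (S := S) N‖ * ‖x 0‖ *
          (‖smulCLM (S := S) N‖ ^ m * (∏ j, ‖x (Fin.succ j)‖) * ‖c‖) := by
        gcongr
        exact ih _
      _ = _ := by ring

/-- The multilinear map `(v_j) ↦ (∏ (v_j)_{w j}) c` given by a word `w` in the variables. -/
def wordMap {m : ℕ} (w : Fin m → Fin M) (c : Fin N → Complexification S) :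
    ContinuousMultilinearMap ℂ (fun _ : Fin m => Fin M → Complexification S)
      (Fin N → Complexification S) :=
  ((smulCLM N).flip c).compContinuousMultilinearMap
    ((ContinuousMultilinearMap.mkPiAlgebra ℂ (Fin m) (Complexification S)).compContinuousLinearMap
      fun j => ContinuousLinearMap.proj (w j))

theorem wordMap_apply {m : ℕ} (w : Fin m → Fin M) (c : Fin N → Complexification S)
    (v : Fin m → Fin M → Complexification S) : wordMap w c v = (∏ j, v j (w j)) • c := rfl

theorem norm_wordMap_le {m : ℕ} (w : Fin m → Fin M) (c : Fin N → Complexification S) :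
    ‖wordMap w c‖ ≤ ‖smulCLM (S := S) N‖ ^ m * ‖c‖ := by
  refine ContinuousMultilinearMap.opNorm_le_bound (by positivity) fun v => ?_
  rw [wordMap_apply, mul_right_comm]
  refine (norm_prod_smul_le _ c).trans ?_
  gcongr with j
  exact norm_le_pi_norm (v j) (w j)

theorem wordMap_update_smul {m : ℕ} (w : Fin m → Fin M) (c : Fin N → Complexification S)
    (v : Fin m → Fin M → Complexification S) (j : Fin m) (a : Complexification S) :
    wordMap w c (Function.update v j (a • v j)) = a • wordMap w c v := by
  have hprod : ∏ i, Function.update v j (a • v j) i (w i) = a * ∏ i, v i (w i) := by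
    rw [← Finset.mul_prod_erase _ _ (Finset.mem_univ j),
      ← Finset.mul_prod_erase _ (fun i => v i (w i)) (Finset.mem_univ j), Function.update_self,
      Pi.smul_apply, smul_eq_mul, mul_assoc]
    congr 2
    refine Finset.prod_congr rfl fun i hi => ?_
    rw [Function.update_of_ne (Finset.ne_of_mem_erase hi)]
  rw [wordMap_apply, wordMap_apply, hprod, mul_smul]

/-- A word of length `m = ∑ α i` in which the letter `i` occurs `α i` times. -/
def wordOf (α : Fin M → ℕ) {m : ℕ} (hα : ∑ i, α i = m) (j : Fin m) : Fin M :=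
  (finSigmaFinEquiv.symm (Fin.cast hα.symm j)).1

theorem prod_wordOf {R : Type*} [CommMonoid R] {α : Fin M → ℕ} {m : ℕ} (hα : ∑ i, α i = m)
    (H : Fin M → R) : ∏ j, H (wordOf α hα j) = ∏ i, H i ^ α i := by
  subst hα
  rw [← finSigmaFinEquiv.prod_comp]
  simp [wordOf, Fintype.prod_sigma]

instance (m : ℕ) : Fintype {α : Fin M → ℕ // ∑ i, α i = m} :=
  Fintype.subtype (Finset.piAntidiag Finset.univ m) (by simp)

/-- The decomposition of multi-indices by degree. -/
def degreeEquiv (M : ℕ) : (Σ m : ℕ, {α : Fin M → ℕ // ∑ i, α i = m}) ≃ (Fin M → ℕ) :=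
  Equiv.sigmaFiberEquiv fun α : Fin M → ℕ => ∑ i, α i

/-- The power series `∑ c_α H^α` with its homogeneous terms written as multilinear maps. -/
def seriesOf (c : (Fin M → ℕ) → Fin N → Complexification S) :
    FormalMultilinearSeries ℂ (Fin M → Complexification S) (Fin N → Complexification S) :=
  fun m => ∑ α : {α : Fin M → ℕ // ∑ i, α i = m}, wordMap (wordOf α.1 α.2) (c α.1)

theorem seriesOf_apply_diag (c : (Fin M → ℕ) → Fin N → Complexification S) (m : ℕ)
    (H : Fin M → Complexification S) :
    (seriesOf c m fun _ => H) =
      ∑ α : {α : Fin M → ℕ // ∑ i, α i = m}, (∏ i, H i ^ α.1 i) • c α.1 := by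
  simp only [seriesOf, sum_apply, wordMap_apply, prod_wordOf]

theorem seriesOf_update_smul (c : (Fin M → ℕ) → Fin N → Complexification S) (m : ℕ)
    (v : Fin m → Fin M → Complexification S) (j : Fin m) (a : Complexification S) :
    seriesOf c m (Function.update v j (a • v j)) = a • seriesOf c m v := by
  simp only [seriesOf, sum_apply, wordMap_update_smul, Finset.smul_sum]

theorem exists_summable_of_eventually_summable {c : (Fin M → ℕ) → Fin N → Complexification S}
    (hc : ∀ᶠ H in 𝓝 (0 : Fin M → Complexification S),
      Summable fun α : Fin M → ℕ => (∏ i, H i ^ α i) • c α) :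
    ∃ t : ℝ, 0 < t ∧ Summable fun α : Fin M → ℕ => t ^ (∑ i, α i) * ‖c α‖ := by
  have hcont : Continuous fun t : ℝ => (t : ℂ) • (1 : Fin M → Complexification S) := by fun_prop
  obtain ⟨t, ht, ht0 : 0 < t⟩ := (((hcont.tendsto' 0 0 (by simp)).eventually hc).filter_mono
    nhdsWithin_le_nhds |>.and (self_mem_nhdsWithin (s := Set.Ioi 0))).exists
  refine ⟨t, ht0, ht.norm.congr fun α => ?_⟩
  have hprod : ∏ i, ((t : ℂ) • (1 : Fin M → Complexification S)) i ^ α i =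
      algebraMap ℂ (Complexification S) ((t : ℂ) ^ (∑ i, α i)) := by
    simp [Algebra.smul_def, Finset.prod_pow_eq_pow_sum]
  rw [hprod, algebraMap_smul, norm_smul, norm_pow, Complex.norm_real, Real.norm_of_nonneg ht0.le]

theorem seriesOf_radius_pos {c : (Fin M → ℕ) → Fin N → Complexification S} {t : ℝ} (ht : 0 < t)
    (hc : Summable fun α : Fin M → ℕ => t ^ (∑ i, α i) * ‖c α‖) : 0 < (seriesOf c).radius := by
  set K := ‖smulCLM (S := S) N‖
  obtain ⟨r, hr, hrt⟩ := exists_pos_mul_lt ht K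
  lift r to NNReal using hr.le
  refine (ENNReal.coe_pos.2 hr).trans_le ((seriesOf c).le_radius_of_summable_norm ?_)
  refine .of_nonneg_of_le (fun m => by positivity) (fun m => ?_)
    ((degreeEquiv M).summable_iff.2 hc).sigma
  rw [tsum_fintype]
  calc ‖seriesOf c m‖ * (r : ℝ) ^ m
      ≤ (∑ α : {α : Fin M → ℕ // ∑ i, α i = m}, K ^ m * ‖c α.1‖) * (r : ℝ) ^ m := by
        gcongr
        exact norm_sum_le_of_le _ fun α _ => norm_wordMap_le _ _
    _ = ∑ α : {α : Fin M → ℕ // ∑ i, α i = m}, (K * r) ^ m * ‖c α.1‖ := by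
        rw [Finset.sum_mul]
        exact Finset.sum_congr rfl fun α _ => by ring
    _ ≤ ∑ α : {α : Fin M → ℕ // ∑ i, α i = m}, t ^ (∑ i, α.1 i) * ‖c α.1‖ := by
        refine Finset.sum_le_sum fun α _ => ?_
        rw [α.2]
        gcongr

theorem hasFPowerSeriesAt_seriesOf {c : (Fin M → ℕ) → Fin N → Complexification S}
    {F : (Fin M → Complexification S) → Fin N → Complexification S}
    (hF : ∀ᶠ H in 𝓝 (0 : Fin M → Complexification S),
      HasSum (fun α : Fin M → ℕ => (∏ i, H i ^ α i) • c α) (F H)) :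
    HasFPowerSeriesAt F (seriesOf c) 0 := by
  obtain ⟨t, ht, hc⟩ := exists_summable_of_eventually_summable (hF.mono fun H hH => hH.summable)
  refine ((seriesOf c).hasFPowerSeriesOnBall (seriesOf_radius_pos ht hc)).hasFPowerSeriesAt.congr ?_
  filter_upwards [hF] with H hH
  refine (((degreeEquiv M).hasSum_iff.2 hH).sigma fun m => ?_).tsum_eq
  rw [seriesOf_apply_diag]
  exact hasSum_fintype _

theorem SAnalyticAt.intertwinesAt {F : (Fin M → Complexification S) → Fin N → Complexification S}
    {P : Fin M → Complexification S} (hF : SAnalyticAt F P) (a : Complexification S) :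
    IntertwinesAt (smulCLM M a) (smulCLM N a) F P := by
  obtain ⟨c, hc⟩ := hF
  refine .of_hasFPowerSeriesAt ?_ fun m v i => seriesOf_update_smul c m v i a
  simpa using (hasFPowerSeriesAt_seriesOf hc).comp_sub P

/-- The multi-index of the monomial spelled by a word. -/
def letterCount {m : ℕ} (w : Fin m → Fin M) (i : Fin M) : ℕ := Fintype.card {j // w j = i}

theorem sum_letterCount {m : ℕ} (w : Fin m → Fin M) : ∑ i, letterCount w i = m := by
  simp only [letterCount, ← Fintype.card_sigma, Fintype.card_congr (Equiv.sigmaFiberEquiv w),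
    Fintype.card_fin]

theorem prod_comp_word {R : Type*} [CommMonoid R] (H : Fin M → R) {m : ℕ} (w : Fin m → Fin M) :
    ∏ j, H (w j) = ∏ i, H i ^ letterCount w i := by
  rw [← Fintype.prod_fiberwise w]
  refine Finset.prod_congr rfl fun i _ => ?_
  rw [Fintype.prod_congr _ (fun _ => H i) fun j => congrArg H j.2]
  simp [letterCount]

instance (α : Fin M → ℕ) : Finite {x : Σ m : ℕ, Fin m → Fin M // letterCount x.2 = α} := by
  refine Set.Finite.subset (Set.finite_range (Sigma.mk (∑ i, α i))) ?_
  rintro ⟨m, w⟩ (rfl : letterCount w = α)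
  rw [sum_letterCount]
  exact ⟨w, rfl⟩

/-- The coefficients of the power series in commuting variables obtained from a series over words
by collecting all words that spell the same monomial. -/
def collectWords (d : (Σ m : ℕ, Fin m → Fin M) → Fin N → Complexification S) (α : Fin M → ℕ) :
    Fin N → Complexification S :=
  ∑' x : {x : Σ m : ℕ, Fin m → Fin M // letterCount x.2 = α}, d x

theorem hasSum_collectWords {d : (Σ m : ℕ, Fin m → Fin M) → Fin N → Complexification S}
    {H : Fin M → Complexification S} {y : Fin N → Complexification S}
    (h : HasSum (fun x => (∏ j, H (x.2 j)) • d x) y) :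
    HasSum (fun α : Fin M → ℕ => (∏ i, H i ^ α i) • collectWords d α) y := by
  refine ((Equiv.sigmaFiberEquiv fun x : Σ m : ℕ, Fin m → Fin M =>
    letterCount x.2).hasSum_iff.2 h).sigma fun α => ?_
  refine ((smulCLM N (∏ i, H i ^ α i)).hasSum Summable.of_finite.hasSum).congr_fun ?_
  rintro ⟨x, rfl⟩
  exact congrArg (· • d x) (prod_comp_word H x.2)

theorem eventually_summable_words {d : (Σ m : ℕ, Fin m → Fin M) → Fin N → Complexification S}
    {C r : ℝ} (hC : 0 ≤ C) (hr : 0 ≤ r) (hd : ∀ x, ‖d x‖ ≤ C * r ^ x.1) :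
    ∀ᶠ H in 𝓝 (0 : Fin M → Complexification S), Summable fun x => (∏ j, H (x.2 j)) • d x := by
  set K := ‖smulCLM (S := S) N‖
  have hcont : Continuous fun H : Fin M → Complexification S => M * (K * ‖H‖ * r) := by fun_prop
  filter_upwards [(hcont.tendsto' 0 0 (by simp)).eventually (gt_mem_nhds one_pos)] with H hH
  have hgeom : Summable fun x : Σ m : ℕ, Fin m → Fin M => C * (K * ‖H‖ * r) ^ x.1 := by
    refine (summable_sigma_of_nonneg fun x => by positivity).2 ⟨fun m => .of_finite, ?_⟩
    refine ((summable_geometric_of_lt_one (by positivity) hH).mul_left C).congr fun m => ?_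
    simp only [tsum_fintype, Finset.sum_const, Finset.card_univ, Fintype.card_fun,
      Fintype.card_fin, nsmul_eq_mul, Nat.cast_pow]
    ring
  refine .of_norm_bounded hgeom fun x => ?_
  calc ‖(∏ j, H (x.2 j)) • d x‖ ≤ K ^ x.1 * (∏ j, ‖H (x.2 j)‖) * ‖d x‖ := norm_prod_smul_le _ _
    _ ≤ K ^ x.1 * ‖H‖ ^ x.1 * (C * r ^ x.1) := by
      gcongr
      · exact (Finset.prod_le_prod (fun j _ => norm_nonneg _) fun j _ =>
          norm_le_pi_norm H _).trans_eq (by simp)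
      · exact hd x
    _ = C * (K * ‖H‖ * r) ^ x.1 := by ring

theorem apply_diag_eq_sum_words {m : ℕ}
    {q : ContinuousMultilinearMap ℂ (fun _ : Fin m => Fin M → Complexification S)
      (Fin N → Complexification S)}
    (hq : ∀ v i (a : Complexification S), q (Function.update v i (a • v i)) = a • q v)
    (H : Fin M → Complexification S) :
    q (fun _ => H) = ∑ w : Fin m → Fin M, (∏ j, H (w j)) • q fun j => Pi.single (w j) 1 := by
  let Q : MultilinearMap (Complexification S) (fun _ : Fin m => Fin M → Complexification S)
      (Fin N → Complexification S) :=
    { toFun := q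
      map_update_add' := fun {inst} v i x y => by
        obtain rfl : inst = instDecidableEqFin m := Subsingleton.elim _ _
        exact q.map_update_add v i x y
      map_update_smul' := fun {inst} v i a x => by
        obtain rfl : inst = instDecidableEqFin m := Subsingleton.elim _ _
        simpa using hq (Function.update v i x) i a }
  calc Q (fun _ => H)
      = Q fun _ => ∑ i, H i • Pi.single i 1 := by rw [← pi_eq_sum_univ' H]
    _ = _ := by
      rw [Q.map_sum]
      exact Finset.sum_congr rfl fun w _ => Q.map_smul_univ _ _

theorem sAnalyticAt_of_hasFPowerSeriesAt
    {F : (Fin M → Complexification S) → Fin N → Complexification S}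
    {P : Fin M → Complexification S}
    {q : FormalMultilinearSeries ℂ (Fin M → Complexification S) (Fin N → Complexification S)}
    (hF : HasFPowerSeriesAt F q P)
    (hq : ∀ m v i (a : Complexification S), q m (Function.update v i (a • v i)) = a • q m v) :
    SAnalyticAt F P := by
  let d (x : Σ m : ℕ, Fin m → Fin M) : Fin N → Complexification S :=
    q x.1 fun j => Pi.single (x.2 j) 1
  obtain ⟨C, r, hC, hr, hqr⟩ := q.le_mul_pow_of_radius_pos hF.radius_pos
  have hd (x) : ‖d x‖ ≤ C * (r * ‖(1 : Complexification S)‖) ^ x.1 := by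
    refine ((q x.1).le_of_opNorm_le (hqr x.1) _).trans_eq ?_
    simp only [Pi.norm_single, Finset.prod_const, Finset.card_univ, Fintype.card_fin]
    ring
  refine ⟨collectWords d, ?_⟩
  filter_upwards [eventually_summable_words hC.le (by positivity) hd, hF.eventually_hasSum]
    with H hsum hH
  refine hasSum_collectWords (hH.sigma_of_hasSum (fun m => ?_) hsum)
  rw [apply_diag_eq_sum_words (hq m)]
  exact hasSum_fintype _

theorem sAnalyticAt_iff {F : (Fin M → Complexification S) → Fin N → Complexification S}
    {P : Fin M → Complexification S} :
    SAnalyticAt F P ↔ ∀ a, IntertwinesAt (smulCLM M a) (smulCLM N a) F P := by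
  refine ⟨SAnalyticAt.intertwinesAt, fun hF => ?_⟩
  refine sAnalyticAt_of_hasFPowerSeriesAt (hasFPowerSeriesAt_iteratedFDeriv (hF 0).analyticAt)
    fun m v i a => ?_
  have := (hF a).iteratedFDeriv_comm m v i
  simp only [smulCLM_apply] at this
  simp only [smul_apply, this, smul_comm _ a]

theorem SAnalyticAt.eventually {F : (Fin M → Complexification S) → Fin N → Complexification S}
    {P : Fin M → Complexification S} (hF : SAnalyticAt F P) : ∀ᶠ Z in 𝓝 P, SAnalyticAt F Z := by
  obtain ⟨r, hr, hball⟩ := (hF.intertwinesAt 0).analyticAt.exists_ball_analyticOnNhd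
  filter_upwards [Metric.ball_mem_nhds P hr] with Z hZ
  exact sAnalyticAt_iff.2 fun a => .of_isPreconnected hball (convex_ball P r).isPreconnected
    Metric.isOpen_ball (Metric.mem_ball_self hr) (hF.intertwinesAt a) hZ

end PowerSeries

/-! ### Time-one maps of flows -/

section Flow

variable {V : Type*} [NormedAddCommGroup V] [NormedSpace ℝ V]

open Metric Set

/-- Quantitative smoothness of `f` on the closed ball of radius `δ` about `x`: a Lipschitz constant
`L`, and a constant `M` for the quadratic error of the linearization at the centre. -/
structure HasBoundsOnBall (f : V → V) (L : NNReal) (M δ : ℝ) (x : V) : Prop where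
  lipschitzOnWith : LipschitzOnWith L f (closedBall x δ)
  norm_sub_sub_fderiv_le :
    ∀ y ∈ closedBall x δ, ‖f y - f x - fderiv ℝ f x (y - x)‖ ≤ M * ‖y - x‖ ^ 2

theorem hasBoundsOnBall_of_norm_fderiv_le {f : V → V} {L : NNReal} {M δ : ℝ} {x : V} {U : Set V}
    (hU : IsOpen U) (hf : ContDiffOn ℝ 2 f U) (hball : closedBall x δ ⊆ U)
    (hL : ∀ y ∈ closedBall x δ, ‖fderiv ℝ f y‖ ≤ L)
    (hM : ∀ y ∈ closedBall x δ, ‖fderiv ℝ (fderiv ℝ f) y‖ ≤ M) : HasBoundsOnBall f L M δ x := by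
  have hf' : ContDiffOn ℝ 1 (fderiv ℝ f) U := hf.fderiv_of_isOpen hU (by norm_num)
  have hd (y) (hy : y ∈ closedBall x δ) : HasFDerivAt f (fderiv ℝ f y) y :=
    ((hf.differentiableOn (by simp)).differentiableAt (hU.mem_nhds (hball hy))).hasFDerivAt
  have hd' (y) (hy : y ∈ closedBall x δ) :
      HasFDerivAt (fderiv ℝ f) (fderiv ℝ (fderiv ℝ f) y) y :=
    ((hf'.differentiableOn (by simp)).differentiableAt (hU.mem_nhds (hball hy))).hasFDerivAt
  refine ⟨(convex_closedBall x δ).lipschitzOnWith_of_nnnorm_hasFDerivWithin_le (𝕜 := ℝ)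
    (fun y hy => (hd y hy).hasFDerivWithinAt) hL, fun y hy => ?_⟩
  have hsub : closedBall x ‖y - x‖ ⊆ closedBall x δ :=
    closedBall_subset_closedBall (mem_closedBall_iff_norm.1 hy)
  have hx' : x ∈ closedBall x ‖y - x‖ := mem_closedBall_self (norm_nonneg _)
  have hy' : y ∈ closedBall x ‖y - x‖ := mem_closedBall_iff_norm.2 le_rfl
  have hM0 : 0 ≤ M := (norm_nonneg _).trans (hM y hy)
  have hbound (z) (hz : z ∈ closedBall x ‖y - x‖) :
      ‖fderiv ℝ f z - fderiv ℝ f x‖ ≤ M * ‖y - x‖ := by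
    refine ((convex_closedBall x ‖y - x‖).norm_image_sub_le_of_norm_hasFDerivWithin_le (𝕜 := ℝ)
      (fun u hu => (hd' u (hsub hu)).hasFDerivWithinAt) (fun u hu => hM u (hsub hu)) hx'
      hz).trans ?_
    gcongr
    exact mem_closedBall_iff_norm.1 hz
  refine ((convex_closedBall x ‖y - x‖).norm_image_sub_le_of_norm_hasFDerivWithin_le' (𝕜 := ℝ)
    (fun z hz => (hd z (hsub hz)).hasFDerivWithinAt) hbound hx' hy').trans_eq (by ring)

theorem exists_hasBoundsOnBall [ProperSpace V] {f : V → V} {U K : Set V} (hU : IsOpen U)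
    (hf : ContDiffOn ℝ 2 f U) (hK : IsCompact K) (hKU : K ⊆ U) :
    ∃ δ > 0, ∃ L, ∃ M ≥ 0, ∀ x ∈ K, HasBoundsOnBall f L M δ x := by
  obtain ⟨δ, hδ, hsub⟩ := hK.exists_cthickening_subset_open hU hKU
  have hf' : ContDiffOn ℝ 1 (fderiv ℝ f) U := hf.fderiv_of_isOpen hU (by norm_num)
  obtain ⟨L, hL⟩ := hK.cthickening.exists_bound_of_continuousOn (hf'.continuousOn.mono hsub)
  obtain ⟨M, hM⟩ := hK.cthickening.exists_bound_of_continuousOn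
    ((hf'.continuousOn_fderiv_of_isOpen hU le_rfl).mono hsub)
  refine ⟨δ, hδ, L.toNNReal, max M 0, le_max_right _ _, fun x hx => ?_⟩
  have hball : closedBall x δ ⊆ cthickening δ K := closedBall_subset_cthickening hx δ
  exact hasBoundsOnBall_of_norm_fderiv_le hU hf (hball.trans hsub)
    (fun y hy => (hL y (hball hy)).trans (Real.le_coe_toNNReal L))
    fun y hy => (hM y (hball hy)).trans (le_max_left _ _)

/-- `x` solves the equation `dx/dt = f(x)` over the unit interval. -/
def IsSolution (f : V → V) (x : ℝ → V) : Prop :=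
  ∀ t ∈ Icc (0 : ℝ) 1, HasDerivWithinAt x (f (x t)) (Icc 0 1) t

theorem IsSolution.continuousOn {f : V → V} {x : ℝ → V} (hx : IsSolution f x) :
    ContinuousOn x (Icc 0 1) := fun t ht => (hx t ht).continuousWithinAt

theorem hasDerivWithinAt_Ici_of_Icc {x : ℝ → V} {x' : V} {t : ℝ} (ht : t ∈ Ico (0 : ℝ) 1)
    (hx : HasDerivWithinAt x x' (Icc 0 1) t) : HasDerivWithinAt x x' (Ici t) t :=
  hx.mono_of_mem_nhdsWithin (Icc_mem_nhdsGE_of_mem ht)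

theorem forall_le_of_bootstrap {φ : ℝ → ℝ} {c δ : ℝ} (hφ : ContinuousOn φ (Icc 0 1)) (hc : c < δ)
    (h : ∀ T ∈ Icc (0 : ℝ) 1, (∀ t ∈ Ico 0 T, φ t ≤ δ) → φ T ≤ c) :
    ∀ t ∈ Icc (0 : ℝ) 1, φ t ≤ c := by
  have hlt : ∀ t ∈ Icc (0 : ℝ) 1, φ t < δ := by
    by_contra! ⟨t, ht, hδt⟩
    have hcompact : IsCompact (Icc (0 : ℝ) 1 ∩ φ ⁻¹' Ici δ) :=
      isCompact_Icc.of_isClosed_subset (hφ.preimage_isClosed_of_isClosed isClosed_Icc isClosed_Ici)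
        inter_subset_left
    obtain ⟨s, ⟨hs, hδs : δ ≤ φ s⟩, hmin⟩ := hcompact.exists_isLeast ⟨t, ht, hδt⟩
    refine (hδs.trans (h s hs fun r hr => ?_)).not_gt hc
    by_contra! hr'
    exact (hmin ⟨⟨hr.1, hr.2.le.trans hs.2⟩, hr'.le⟩).not_gt hr.2
  exact fun t ht => h t ht fun s hs => (hlt s ⟨hs.1, hs.2.le.trans ht.2⟩).le

theorem IsSolution.dist_le {f : V → V} {x y : ℝ → V} {δ : ℝ} {L : NNReal}
    (hx : IsSolution f x) (hy : IsSolution f y)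
    (hf : ∀ t ∈ Icc (0 : ℝ) 1, LipschitzOnWith L f (closedBall (x t) δ))
    (h0 : dist (y 0) (x 0) * Real.exp L < δ) :
    ∀ t ∈ Icc (0 : ℝ) 1, dist (y t) (x t) ≤ dist (y 0) (x 0) * Real.exp L := by
  have hδ : 0 ≤ δ := le_trans (by positivity) h0.le
  refine forall_le_of_bootstrap
    (continuous_dist.comp_continuousOn (hy.continuousOn.prodMk hx.continuousOn)) h0
    fun T hT htube => ?_
  have hIcc : Icc 0 T ⊆ Icc (0 : ℝ) 1 := Icc_subset_Icc_right hT.2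
  have hIco {t : ℝ} (ht : t ∈ Ico 0 T) : t ∈ Ico (0 : ℝ) 1 := ⟨ht.1, ht.2.trans_le hT.2⟩
  refine (dist_le_of_trajectories_ODE_of_mem (v := fun _ => f) (s := fun t => closedBall (x t) δ)
    (fun t ht => hf t (Ico_subset_Icc_self (hIco ht)))
    (hy.continuousOn.mono hIcc)
    (fun t ht => hasDerivWithinAt_Ici_of_Icc (hIco ht) (hy t (Ico_subset_Icc_self (hIco ht))))
    htube (hx.continuousOn.mono hIcc)
    (fun t ht => hasDerivWithinAt_Ici_of_Icc (hIco ht) (hx t (Ico_subset_Icc_self (hIco ht))))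
    (fun t _ => mem_closedBall_self hδ) le_rfl T ⟨hT.1, le_rfl⟩).trans ?_
  gcongr
  rw [sub_zero]
  exact mul_le_of_le_one_right L.2 hT.2

theorem gronwallBound_zero_one_le {K ε : ℝ} (hK : 0 ≤ K) (hε : 0 ≤ ε) :
    gronwallBound 0 K ε 1 ≤ ε * Real.exp K := by
  obtain rfl | hK := hK.eq_or_lt
  · simp [gronwallBound_K0]
  have hexp : Real.exp K - 1 ≤ K * Real.exp K := by
    have h := mul_le_mul_of_nonneg_right (Real.one_sub_le_exp_neg K) (Real.exp_pos K).le
    rw [← Real.exp_add, neg_add_cancel, Real.exp_zero] at h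
    linarith
  simp only [gronwallBound_of_K_ne_0 hK.ne', zero_mul, zero_add, mul_one]
  calc ε / K * (Real.exp K - 1) ≤ ε / K * (K * Real.exp K) := by gcongr
    _ = ε * Real.exp K := by field_simp

theorem HasBoundsOnBall.norm_add_clm_sub_le {f : V → V} {L : NNReal} {M δ : ℝ} {a b : V}
    {A : V →L[ℝ] V} (hf : HasBoundsOnBall f L M δ a)
    (hA : ∀ h, fderiv ℝ f a (A h) = A (fderiv ℝ f a h)) (hM : 0 ≤ M) (hb : b ∈ closedBall a δ)
    (hAb : a + A (b - a) ∈ closedBall a δ) :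
    ‖f a + A (f b - f a) - f (a + A (b - a))‖ ≤ (‖A‖ + ‖A‖ ^ 2) * M * ‖b - a‖ ^ 2 := by
  have hAerr := hf.norm_sub_sub_fderiv_le _ hAb
  rw [add_sub_cancel_left, hA] at hAerr
  calc ‖f a + A (f b - f a) - f (a + A (b - a))‖
      = ‖A (f b - f a - fderiv ℝ f a (b - a)) -
          (f (a + A (b - a)) - f a - A (fderiv ℝ f a (b - a)))‖ := by
        rw [map_sub A (f b - f a)]
        abel_nf
    _ ≤ ‖A‖ * (M * ‖b - a‖ ^ 2) + M * (‖A‖ * ‖b - a‖) ^ 2 := by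
        refine norm_sub_le_of_le (A.le_opNorm_of_le (hf.norm_sub_sub_fderiv_le b hb))
          (hAerr.trans ?_)
        gcongr
        exact A.le_opNorm _
    _ = _ := by ring

/-- If the derivatives of `f` along the solution `x` commute with `A`, then for every nearby
solution `y` the curve `x + A (y - x)` solves the equation up to a quadratic error. -/
theorem IsSolution.dist_add_clm_le {f : V → V} {A : V →L[ℝ] V} {x y z : ℝ → V} {δ M : ℝ}
    {L : NNReal} (hx : IsSolution f x) (hy : IsSolution f y) (hz : IsSolution f z)
    (hA : ∀ t ∈ Icc (0 : ℝ) 1, ∀ h, fderiv ℝ f (x t) (A h) = A (fderiv ℝ f (x t) h))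
    (hf : ∀ t ∈ Icc (0 : ℝ) 1, HasBoundsOnBall f L M δ (x t)) (hM : 0 ≤ M)
    (hz0 : z 0 = x 0 + A (y 0 - x 0)) (hyδ : dist (y 0) (x 0) * Real.exp L < δ)
    (hAδ : ‖A‖ * (dist (y 0) (x 0) * Real.exp L) < δ) :
    dist (z 1) (x 1 + A (y 1 - x 1)) ≤
      (‖A‖ + ‖A‖ ^ 2) * M * (dist (y 0) (x 0) * Real.exp L) ^ 2 * Real.exp L := by
  set d := dist (y 0) (x 0) * Real.exp L with hd
  have hlip (t) (ht : t ∈ Icc (0 : ℝ) 1) := (hf t ht).lipschitzOnWith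
  have hyx (t) (ht : t ∈ Icc (0 : ℝ) 1) : dist (y t) (x t) ≤ d := hx.dist_le hy hlip hyδ t ht
  have hz0x : dist (z 0) (x 0) * Real.exp L ≤ ‖A‖ * d := by
    rw [hz0, dist_self_add_left, hd, dist_eq_norm, ← mul_assoc]
    gcongr
    exact A.le_opNorm _
  have hzx (t) (ht : t ∈ Icc (0 : ℝ) 1) : z t ∈ closedBall (x t) δ :=
    (hx.dist_le hz hlip (hz0x.trans_lt hAδ) t ht).trans (hz0x.trans hAδ.le)
  let w (t : ℝ) : V := x t + A (y t - x t)
  have hwx (t) (ht : t ∈ Icc (0 : ℝ) 1) : w t ∈ closedBall (x t) δ := by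
    rw [mem_closedBall, dist_self_add_left]
    exact (A.le_opNorm_of_le ((dist_eq_norm _ _).ge.trans (hyx t ht))).trans hAδ.le
  have hw (t) (ht : t ∈ Icc (0 : ℝ) 1) :
      HasDerivWithinAt w (f (x t) + A (f (y t) - f (x t))) (Icc 0 1) t :=
    (hx t ht).add (A.hasFDerivAt.comp_hasDerivWithinAt t ((hy t ht).sub (hx t ht)))
  have hIco : Ico (0 : ℝ) 1 ⊆ Icc 0 1 := Ico_subset_Icc_self
  have hgronwall := dist_le_of_approx_trajectories_ODE_of_mem (v := fun _ => f)
    (s := fun t => closedBall (x t) δ) (δ := 0) (εf := 0) (εg := (‖A‖ + ‖A‖ ^ 2) * M * d ^ 2)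
    (fun t ht => hlip t (hIco ht)) hz.continuousOn
    (fun t ht => hasDerivWithinAt_Ici_of_Icc ht (hz t (hIco ht))) (fun t _ => (dist_self _).le)
    (fun t ht => hzx t (hIco ht)) (fun t ht => (hw t ht).continuousWithinAt)
    (fun t ht => hasDerivWithinAt_Ici_of_Icc ht (hw t (hIco ht)))
    (fun t ht => by
      have hyt := hyx t (hIco ht)
      rw [dist_eq_norm]
      refine ((hf t (hIco ht)).norm_add_clm_sub_le (hA t (hIco ht)) hM (hyt.trans hyδ.le)
        (hwx t (hIco ht))).trans ?_
      rw [← dist_eq_norm]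
      gcongr)
    (fun t ht => hwx t (hIco ht)) (by simp [w, hz0]) 1 ⟨zero_le_one, le_rfl⟩
  rw [zero_add, sub_zero] at hgronwall
  exact hgronwall.trans (gronwallBound_zero_one_le L.2 (by positivity))

theorem timeOne_isBigO [ProperSpace V] {f e : V → V} {U : Set V} (hU : IsOpen U)
    (hf : ContDiffOn ℝ 2 f U) {A : V →L[ℝ] V}
    (hA : ∀ x ∈ U, ∀ h, fderiv ℝ f x (A h) = A (fderiv ℝ f x h)) {p : V}
    (he : ∀ᶠ q in 𝓝 p, ∃ γ : ℝ → V, γ 0 = q ∧ γ 1 = e q ∧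
      ∀ t ∈ Icc (0 : ℝ) 1, γ t ∈ U ∧ HasDerivWithinAt γ (f (γ t)) (Icc 0 1) t) :
    (fun h => e (p + A h) - (e p + A (e (p + h) - e p))) =O[𝓝 0] fun h => ‖h - 0‖ ^ 2 := by
  obtain ⟨x, hx0, hx1, hx⟩ := he.self_of_nhds
  have hxs : IsSolution f x := fun t ht => (hx t ht).2
  obtain ⟨δ, hδ, L, M, hM, hbounds⟩ := exists_hasBoundsOnBall hU hf
    (isCompact_Icc.image_of_continuousOn hxs.continuousOn)
    (image_subset_iff.2 fun t ht => (hx t ht).1)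
  have hp : Continuous fun h : V => p + h := by fun_prop
  have hpA : Continuous fun h : V => p + A h := by fun_prop
  have hsmall : Continuous fun h : V => ‖h‖ * Real.exp L := by fun_prop
  have hAsmall : Continuous fun h : V => ‖A‖ * (‖h‖ * Real.exp L) := by fun_prop
  refine .of_bound ((‖A‖ + ‖A‖ ^ 2) * M * Real.exp L ^ 2 * Real.exp L) ?_
  filter_upwards [(hp.tendsto' 0 p (by simp)).eventually he,
    (hpA.tendsto' 0 p (by simp)).eventually he,
    (hsmall.tendsto' 0 0 (by simp)).eventually (gt_mem_nhds hδ),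
    (hAsmall.tendsto' 0 0 (by simp)).eventually (gt_mem_nhds hδ)] with h hy hz hhδ hAδ
  obtain ⟨y, hy0, hy1, hy⟩ := hy
  obtain ⟨z, hz0, hz1, hz⟩ := hz
  have hdist : dist (y 0) (x 0) = ‖h‖ := by rw [hy0, hx0, dist_self_add_left]
  have key := hxs.dist_add_clm_le (A := A) (fun t ht => (hy t ht).2) (fun t ht => (hz t ht).2)
    (fun t ht => hA _ (hx t ht).1) (fun t ht => hbounds _ (mem_image_of_mem x ht)) hM
    (by simp [hx0, hy0, hz0]) (by rwa [hdist]) (by rwa [hdist])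
  rw [hdist, hx1, hy1, hz1, dist_eq_norm, mul_pow] at key
  refine key.trans_eq ?_
  simp only [sub_zero, norm_pow, norm_norm]
  ring

theorem fderiv_timeOne_comm [ProperSpace V] {f e : V → V} {U : Set V} (hU : IsOpen U)
    (hf : ContDiffOn ℝ 2 f U) {A : V →L[ℝ] V}
    (hA : ∀ x ∈ U, ∀ h, fderiv ℝ f x (A h) = A (fderiv ℝ f x h)) {p : V}
    (hd : DifferentiableAt ℝ e p)
    (he : ∀ᶠ q in 𝓝 p, ∃ γ : ℝ → V, γ 0 = q ∧ γ 1 = e q ∧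
      ∀ t ∈ Icc (0 : ℝ) 1, γ t ∈ U ∧ HasDerivWithinAt γ (f (γ t)) (Icc 0 1) t) (h : V) :
    fderiv ℝ e p (A h) = A (fderiv ℝ e p h) := by
  have hderiv (B : V →L[ℝ] V) :
      HasFDerivAt (fun h => e (p + B h)) ((fderiv ℝ e p).comp B) 0 :=
    HasFDerivAt.comp (g := e) (0 : V) (by simpa using hd.hasFDerivAt) (B.hasFDerivAt.const_add p)
  have hzero := (timeOne_isBigO hU hf hA he).hasFDerivAt (𝕜 := ℝ) one_lt_two
  have hdiff := (hderiv A).sub ((A.hasFDerivAt.comp (0 : V)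
    ((hderiv (.id ℝ V)).sub_const (e p))).const_add (e p))
  have := DFunLike.congr_fun (hdiff.unique hzero) h
  simpa [sub_eq_zero] using this

end Flow

/-! ### Fields tangent to a model surface -/

namespace ModelSurface

variable {n k : ℕ} (Q : ModelSurface n k)

theorem analyticAt_defFun (j : Fin k) (p : Ambient n k) : AnalyticAt ℝ (Q.defFun j) p := by
  have him : AnalyticAt ℝ (fun p : Ambient n k => (p.2 j).im) p :=
    (Complex.imCLM.comp ((ContinuousLinearMap.proj j).comp
      (.snd ℝ (Fin n → ℂ) (Fin k → ℂ)))).analyticAt p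
  have hΦ : AnalyticAt ℝ (fun p : Ambient n k => MvPolynomial.aeval (varValue p) (Q.Φ j)) p := by
    refine AnalyticAt.aeval_mvPolynomial (fun i => ?_) (Q.Φ j)
    rcases i with (i | i) | i
    · exact (Complex.reCLM.comp ((ContinuousLinearMap.proj i).comp
        (.fst ℝ (Fin n → ℂ) (Fin k → ℂ)))).analyticAt p
    · exact (Complex.imCLM.comp ((ContinuousLinearMap.proj i).comp
        (.fst ℝ (Fin n → ℂ) (Fin k → ℂ)))).analyticAt p
    · exact (Complex.reCLM.comp ((ContinuousLinearMap.proj i).comp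
        (.snd ℝ (Fin n → ℂ) (Fin k → ℂ)))).analyticAt p
  exact him.sub hΦ

theorem hasFDerivAt_defFun (j : Fin k) (p : Ambient n k) :
    HasFDerivAt (Q.defFun j) (fderiv ℝ (Q.defFun j) p) p :=
  (Q.analyticAt_defFun j p).differentiableAt.hasFDerivAt

/-- The embedding `y ↦ (0, i y)` of `ℝ^k` into the space of the variables `(z, w)`. -/
def imEmbedding (n k : ℕ) : (Fin k → ℝ) →L[ℝ] Ambient n k :=
  .inr ℝ (Fin n → ℂ) (Fin k → ℂ) ∘L .pi fun j => .toSpanSingleton ℝ Complex.I ∘L .proj j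

/-- The projection of the ambient space onto the surface along the imaginary directions of `w`.
It turns a function vanishing on the surface into one vanishing identically. -/
def retraction (p : Ambient n k) : Ambient n k := p - imEmbedding n k fun j => Q.defFun j p

theorem retraction_mem (p : Ambient n k) : Q.retraction p ∈ Q.carrier := by
  intro j
  have hvar : varValue (Q.retraction p) = varValue p := by
    funext i
    rcases i with (i | i) | i <;> simp [varValue, retraction, imEmbedding]
  rw [defFun, hvar]
  simp [retraction, imEmbedding, defFun]

theorem retraction_of_mem {p : Ambient n k} (hp : p ∈ Q.carrier) : Q.retraction p = p := by
  have h : (fun j => Q.defFun j p) = 0 := funext hp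
  rw [retraction, h, map_zero, sub_zero]

theorem hasFDerivAt_retraction (p : Ambient n k) :
    HasFDerivAt Q.retraction (ContinuousLinearMap.id ℝ (Ambient n k) -
      imEmbedding n k ∘L .pi fun j => fderiv ℝ (Q.defFun j) p) p :=
  (hasFDerivAt_id p).sub ((imEmbedding n k).hasFDerivAt.comp p
    (hasFDerivAt_pi.2 fun j => Q.hasFDerivAt_defFun j p))

theorem fderiv_eq_zero_of_tangent {h : Ambient n k → ℝ} {p v : Ambient n k}
    {h' : Ambient n k →L[ℝ] ℝ} (hh : HasFDerivAt h h' p) (hp : p ∈ Q.carrier)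
    (h0 : ∀ᶠ q in 𝓝 p, q ∈ Q.carrier → h q = 0) (hv : v ∈ Q.tangent p) : h' v = 0 := by
  have hr := Q.hasFDerivAt_retraction p
  have hcomp : HasFDerivAt (h ∘ Q.retraction) (h' ∘L _) p :=
    HasFDerivAt.comp p (by rwa [Q.retraction_of_mem hp]) hr
  have hlim : Filter.Tendsto Q.retraction (𝓝 p) (𝓝 p) := by
    simpa only [ContinuousAt, Q.retraction_of_mem hp] using hr.continuousAt
  have hzero : h ∘ Q.retraction =ᶠ[𝓝 p] fun _ => 0 :=
    (hlim.eventually h0).mono fun q hq => hq (Q.retraction_mem q)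
  have hv' : (ContinuousLinearMap.pi fun j => fderiv ℝ (Q.defFun j) p) v = 0 := funext hv
  have happly := DFunLike.congr_fun
    (hcomp.unique ((hasFDerivAt_const (0 : ℝ) p).congr_of_eventuallyEq hzero)) v
  simpa [hv'] using happly

theorem lieBracket_mem_tangent {f g : Ambient n k → Ambient n k} {p : Ambient n k}
    (hf : AnalyticAt ℂ f p) (hg : AnalyticAt ℂ g p) (hp : p ∈ Q.carrier)
    (hft : ∀ᶠ q in 𝓝 p, q ∈ Q.carrier → f q ∈ Q.tangent q)
    (hgt : ∀ᶠ q in 𝓝 p, q ∈ Q.carrier → g q ∈ Q.tangent q) :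
    VectorField.lieBracket ℂ f g p ∈ Q.tangent p := by
  intro j
  have hρ := (Q.analyticAt_defFun j p).fderiv.differentiableAt.hasFDerivAt
  have hfg := Q.fderiv_eq_zero_of_tangent
    (hρ.clm_apply (hg.differentiableAt.hasFDerivAt.restrictScalars ℝ)) hp
    (hgt.mono fun q hq hqQ => hq hqQ j) (hft.self_of_nhds hp)
  have hgf := Q.fderiv_eq_zero_of_tangent
    (hρ.clm_apply (hf.differentiableAt.hasFDerivAt.restrictScalars ℝ)) hp
    (hft.mono fun q hq hqQ => hq hqQ j) (hgt.self_of_nhds hp)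
  have hsymm := (ContDiffAt.isSymmSndFDerivAt (n := 2) (Q.analyticAt_defFun j p).contDiffAt
    (by simp)) (f p) (g p)
  simp only [add_apply, ContinuousLinearMap.comp_apply, ContinuousLinearMap.flip_apply,
    ContinuousLinearMap.coe_restrictScalars'] at hfg hgf
  rw [VectorField.lieBracket, map_sub]
  linarith

theorem mk_mem_aut_iff {f : Ambient n k → Ambient n k} (hf : AnalyticAt ℂ f 0) :
    HolField.mk f hf ∈ Q.aut ↔
      ∀ᶠ p in 𝓝 (0 : Ambient n k), p ∈ Q.carrier → f p ∈ Q.tangent p := by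
  constructor
  · rintro ⟨g, hg, hfg, U, hU, hgU⟩
    filter_upwards [HolField.mk_eq_mk.1 hfg, hU] with p hp hpU hpQ
    exact hp ▸ hgU p hpU hpQ
  · exact fun h => ⟨f, hf, rfl, _, h, fun _ hp => hp⟩

/-- The Lie algebra of germs at zero of holomorphic fields tangent to the surface. -/
def autLieSubalgebra : LieSubalgebra ℝ (HolField (Ambient n k)) where
  carrier := Q.aut
  zero_mem' := (Q.mk_mem_aut_iff (f := 0) analyticAt_const).2
    (.of_forall fun _ _ _ => map_zero _)
  add_mem' {X Y} hX hY := by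
    induction X using HolField.ind with | h f hf
    induction Y using HolField.ind with | h g hg
    rw [HolField.mk_add_mk, mk_mem_aut_iff]
    filter_upwards [(Q.mk_mem_aut_iff hf).1 hX, (Q.mk_mem_aut_iff hg).1 hY] with p hfp hgp hp j
    rw [Pi.add_apply, map_add, hfp hp j, hgp hp j, add_zero]
  smul_mem' c X hX := by
    induction X using HolField.ind with | h f hf
    rw [HolField.smul_mk, mk_mem_aut_iff]
    filter_upwards [(Q.mk_mem_aut_iff hf).1 hX] with p hfp hp j
    have hsmul : ((fun _ : Ambient n k => (c : ℂ)) • f) p = c • f p := Complex.coe_smul c (f p)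
    rw [hsmul, map_smul, hfp hp j, smul_zero]
  lie_mem' {X Y} hX hY := by
    induction X using HolField.ind with | h f hf
    induction Y using HolField.ind with | h g hg
    rw [HolField.mk_lie_mk, mk_mem_aut_iff]
    filter_upwards [((Q.mk_mem_aut_iff hf).1 hX).eventually_nhds,
      ((Q.mk_mem_aut_iff hg).1 hY).eventually_nhds, hf.eventually_analyticAt,
      hg.eventually_analyticAt] with p hft hgt hfp hgp hp
    exact Q.lieBracket_mem_tangent hfp hgp hp hft hgt

end ModelSurface

/-! ### `S`-holomorphic fields -/

section SHol

variable {S : Type*} [CommRing S] [Algebra ℝ S] [FiniteDimensional ℝ S] {n k N : ℕ}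
  (ψ : Ambient n k ≃ₗ[ℂ] (Fin N → Complexification S))

/-- Multiplication by an element of the complexified algebra, carried over to the ambient space
by the identification `ψ`. -/
def actionCLM (a : Complexification S) : Ambient n k →L[ℂ] Ambient n k :=
  (ψ.toContinuousLinearEquiv.symm : (Fin N → Complexification S) →L[ℂ] Ambient n k) ∘L
    smulCLM N a ∘L (ψ.toContinuousLinearEquiv : Ambient n k →L[ℂ] Fin N → Complexification S)

variable {ψ}

theorem sHol_iff {f : Ambient n k → Ambient n k} :
    SHol ψ f ↔ ∀ a, IntertwinesAt (actionCLM ψ a) (actionCLM ψ a) f 0 := by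
  let T : Ambient n k →L[ℂ] (Fin N → Complexification S) := ψ.toContinuousLinearEquiv
  let T' : (Fin N → Complexification S) →L[ℂ] Ambient n k := ψ.toContinuousLinearEquiv.symm
  have hT (a v) : T (actionCLM ψ a v) = smulCLM N a (T v) := ψ.apply_symm_apply _
  have hT' (a v) : T' (smulCLM N a v) = actionCLM ψ a (T' v) := by
    change ψ.symm (a • v) = ψ.symm (a • ψ (ψ.symm v))
    rw [ψ.apply_symm_apply]
  rw [SHol, SHolomorphicNearZero, sAnalyticAt_iff]
  refine forall_congr' fun a => ⟨fun h => ?_, fun h => ?_⟩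
  · have h0 : T 0 = 0 := map_zero T
    refine ((IntertwinesAt.comp (f := T) (by rwa [h0])
      (.of_clm T (hT a) 0)).clm_comp T' (hT' a)).congr (.of_forall fun p => ?_)
    change ψ.symm (ψ (f (ψ.symm (ψ p)))) = f p
    rw [ψ.symm_apply_apply, ψ.symm_apply_apply]
  · have h0 : T' 0 = 0 := map_zero T'
    exact (IntertwinesAt.comp (f := T') (by rwa [h0])
      (.of_clm T' (hT' a) 0)).clm_comp T (hT a)

theorem SHol.congr {f g : Ambient n k → Ambient n k} (hf : SHol ψ f) (h : f =ᶠ[𝓝 0] g) :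
    SHol ψ g :=
  sHol_iff.2 fun a => (sHol_iff.1 hf a).congr h

namespace ModelSurface

variable (Q : ModelSurface n k)

theorem mk_mem_autS_iff {f : Ambient n k → Ambient n k} (hf : AnalyticAt ℂ f 0) :
    HolField.mk f hf ∈ Q.autS ψ ↔ HolField.mk f hf ∈ Q.aut ∧ SHol ψ f := by
  refine and_congr_right fun _ => ⟨?_, fun hfS => ⟨f, hf, rfl, hfS⟩⟩
  rintro ⟨g, hg, hfg, hgS⟩
  exact hgS.congr (HolField.mk_eq_mk.1 hfg).symm

variable (ψ)

/-- The Lie algebra of `S`-holomorphic fields tangent to the surface. -/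
def autSLieSubalgebra : LieSubalgebra ℝ Q.autLieSubalgebra where
  carrier := {X | (X : HolField (Ambient n k)) ∈ Q.autS ψ}
  zero_mem' := by
    refine ⟨Q.autLieSubalgebra.zero_mem, 0, analyticAt_const, rfl, ?_⟩
    exact sHol_iff.2 fun a => .const 0 0
  add_mem' := by
    rintro ⟨_, hX⟩ ⟨_, hY⟩ ⟨_, f, hf, rfl, hfS⟩ ⟨_, g, hg, rfl, hgS⟩
    refine ⟨Q.autLieSubalgebra.add_mem hX hY, f + g, hf.add hg, rfl, ?_⟩
    exact sHol_iff.2 fun a => (sHol_iff.1 hfS a).add (sHol_iff.1 hgS a)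
  smul_mem' := by
    rintro c ⟨_, hX⟩ ⟨_, f, hf, rfl, hfS⟩
    refine ⟨Q.autLieSubalgebra.smul_mem c hX, _, _, HolField.smul_mk c hf, ?_⟩
    exact sHol_iff.2 fun a => (sHol_iff.1 hfS a).clm_comp
      ((c : ℂ) • ContinuousLinearMap.id ℂ (Ambient n k)) fun h => by simp
  lie_mem' := by
    rintro ⟨_, hX⟩ ⟨_, hY⟩ ⟨_, f, hf, rfl, hfS⟩ ⟨_, g, hg, rfl, hgS⟩
    refine ⟨Q.autLieSubalgebra.lie_mem hX hY, _, analyticAt_lieBracket hf hg,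
      HolField.mk_lie_mk hf hg, ?_⟩
    exact sHol_iff.2 fun a => (sHol_iff.1 hfS a).lieBracket (sHol_iff.1 hgS a)

end ModelSurface

end SHol

/-! ### Local groups of `S`-holomorphic maps -/

section Groups

variable {V : Type*} [NormedAddCommGroup V]

namespace IsLocalProduct

variable {e₁ e₂ g : OpenPartialHomeomorph V V}

theorem mem_source (h : IsLocalProduct e₁ e₂ g) {x : V} (hx : x ∈ g.source) :
    x ∈ e₁.source ∧ e₁ x ∈ e₂.source := by
  simpa using h.subset hx

theorem eventuallyEq (h : IsLocalProduct e₁ e₂ g) {x : V} (hx : x ∈ g.source) :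
    g =ᶠ[𝓝 x] fun y => e₂ (e₁ y) :=
  h.eqOn.eventuallyEq_of_mem (g.open_source.mem_nhds hx)

theorem symm_apply (h : IsLocalProduct e₁ e₂ g) {y : V} (hy : y ∈ g.target) :
    y ∈ e₂.target ∧ e₂.symm y ∈ e₁.target ∧ g.symm y = e₁.symm (e₂.symm y) := by
  have hx := g.map_target hy
  obtain ⟨hx₁, hx₂⟩ := h.mem_source hx
  have hey : e₂ (e₁ (g.symm y)) = y := (h.eqOn hx).symm.trans (g.right_inv hy)
  have hsymm : e₂.symm y = e₁ (g.symm y) := by rw [← e₂.left_inv hx₂, hey]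
  exact ⟨hey ▸ e₂.map_source hx₂, hsymm ▸ e₁.map_source hx₁, by rw [hsymm, e₁.left_inv hx₁]⟩

end IsLocalProduct

theorem LocalGroupGen.mono {G H : Set (OpenPartialHomeomorph V V)}
    {e : OpenPartialHomeomorph V V} (hGH : G ⊆ H) (he : LocalGroupGen G e) : LocalGroupGen H e := by
  induction he with
  | of e he => exact .of e (hGH he)
  | mul e₁ e₂ g _ _ h h₁ h₂ => exact .mul e₁ e₂ g h₁ h₂ h
  | inv e _ h he => exact .inv e he h

variable [NormedSpace ℂ V]

theorem IsLocalBihol.refl : IsLocalBihol (OpenPartialHomeomorph.refl V) where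
  zero_mem := trivial
  connected := by
    let : NormedSpace ℝ V := NormedSpace.complexToReal
    exact isConnected_univ
  holo _ _ := analyticAt_id
  holo_symm _ _ := analyticAt_id

theorem IsLocalBihol.symm {e : OpenPartialHomeomorph V V} (he : IsLocalBihol e)
    (h : (0 : V) ∈ e.target) : IsLocalBihol e.symm where
  zero_mem := h
  connected := by
    rw [e.symm_source, ← e.image_source_eq_target]
    exact he.connected.image e e.continuousOn
  holo := he.holo_symm
  holo_symm := he.holo

theorem IsLocalProduct.isLocalBihol {e₁ e₂ g : OpenPartialHomeomorph V V}
    (h : IsLocalProduct e₁ e₂ g) (h₁ : IsLocalBihol e₁) (h₂ : IsLocalBihol e₂) :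
    IsLocalBihol g where
  zero_mem := h.zero_mem
  connected := h.connected
  holo x hx := by
    obtain ⟨hx₁, hx₂⟩ := h.mem_source hx
    exact AnalyticAt.congr ((h₂.holo _ hx₂).comp (h₁.holo _ hx₁)) (h.eventuallyEq hx).symm
  holo_symm y hy := by
    obtain ⟨hy₂, hy₁, -⟩ := h.symm_apply hy
    refine AnalyticAt.congr ((h₁.holo_symm _ hy₁).comp (h₂.holo_symm _ hy₂)) ?_
    filter_upwards [g.open_target.mem_nhds hy] with z hz using (h.symm_apply hz).2.2.symm

theorem LocalGroupGen.isLocalBihol {G : Set (OpenPartialHomeomorph V V)}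
    (hG : ∀ e ∈ G, IsLocalBihol e) {e : OpenPartialHomeomorph V V} (he : LocalGroupGen G e) :
    IsLocalBihol e := by
  induction he with
  | of e he => exact hG e he
  | mul e₁ e₂ g _ _ h h₁ h₂ => exact h.isLocalBihol h₁ h₂
  | inv e _ h he => exact he.symm h

end Groups

section SHolGroups

variable {S : Type*} [CommRing S] [Algebra ℝ S] [FiniteDimensional ℝ S] {n k N : ℕ}
  {ψ : Ambient n k ≃ₗ[ℂ] (Fin N → Complexification S)}

theorem SHol.intertwinesAt_of_mem {f : Ambient n k → Ambient n k} {U : Set (Ambient n k)}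
    (hf : SHol ψ f) (hU : IsOpen U) (hUc : IsPreconnected U) (h0 : 0 ∈ U)
    (hfU : AnalyticOnNhd ℂ f U) (a : Complexification S) {x : Ambient n k} (hx : x ∈ U) :
    IntertwinesAt (actionCLM ψ a) (actionCLM ψ a) f x :=
  .of_isPreconnected hfU hUc hU h0 (sHol_iff.1 hf a) hx

theorem IsLocalBihol.intertwinesAt {e : OpenPartialHomeomorph (Ambient n k) (Ambient n k)}
    (he : IsLocalBihol e) (hS : SHol ψ e) (a : Complexification S) {x : Ambient n k}
    (hx : x ∈ e.source) : IntertwinesAt (actionCLM ψ a) (actionCLM ψ a) e x :=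
  hS.intertwinesAt_of_mem e.open_source he.connected.isPreconnected he.zero_mem he.holo a hx

theorem IsLocalProduct.sHol {e₁ e₂ g : OpenPartialHomeomorph (Ambient n k) (Ambient n k)}
    (h : IsLocalProduct e₁ e₂ g) (h₂ : IsLocalBihol e₂) (hS₁ : SHol ψ e₁) (hS₂ : SHol ψ e₂) :
    SHol ψ g :=
  sHol_iff.2 fun a =>
    ((h₂.intertwinesAt hS₂ a (h.mem_source h.zero_mem).2).comp (sHol_iff.1 hS₁ a)).congr
      (h.eventuallyEq h.zero_mem).symm

theorem IsLocalBihol.sHol_symm {e : OpenPartialHomeomorph (Ambient n k) (Ambient n k)}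
    (he : IsLocalBihol e) (hS : SHol ψ e) (h : (0 : Ambient n k) ∈ e.target) :
    SHol ψ e.symm :=
  sHol_iff.2 fun a => (he.intertwinesAt hS a (e.map_target h)).symm h (he.holo_symm 0 h)

namespace ModelSurface

theorem IsExp.sHol {Q : ModelSurface n k} {X : HolField (Ambient n k)}
    {e : OpenPartialHomeomorph (Ambient n k) (Ambient n k)} (he : Q.IsExp X e)
    (hX : X ∈ Q.autS ψ) : SHol ψ e := by
  obtain ⟨hbi, U, f, hf, hU, hUc, h0, hfU, -, rfl, hγ⟩ := he
  have hfS : SHol ψ f := ((Q.mk_mem_autS_iff hf).1 hX).2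
  refine sHol_iff.2 fun a => ⟨hbi.holo 0 hbi.zero_mem, ?_⟩
  have hcomm (x) (hx : x ∈ U) (h) :
      fderiv ℝ f x (actionCLM ψ a h) = actionCLM ψ a (fderiv ℝ f x h) := by
    rw [(hfU x hx).differentiableAt.fderiv_restrictScalars ℝ]
    exact (hfS.intertwinesAt_of_mem hU hUc.isPreconnected h0 hfU a hx).self_comm h
  filter_upwards [e.open_source.mem_nhds hbi.zero_mem] with p hp h
  have hep : DifferentiableAt ℂ e p := (hbi.holo p hp).differentiableAt
  have hflow := fderiv_timeOne_comm hU (hfU.restrictScalars.contDiffOn hU.uniqueDiffOn)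
    (A := (actionCLM ψ a).restrictScalars ℝ) hcomm (hep.restrictScalars ℝ)
    (Filter.mem_of_superset (e.open_source.mem_nhds hp) hγ) h
  rwa [hep.fderiv_restrictScalars ℝ] at hflow

variable (Q : ModelSurface n k)

theorem isLocalBihol_of_mem_expGroup {A : Set (HolField (Ambient n k))}
    {e : OpenPartialHomeomorph (Ambient n k) (Ambient n k)} (he : e ∈ Q.expGroup A) :
    IsLocalBihol e :=
  LocalGroupGen.isLocalBihol (G := {g | ∃ X ∈ A, Q.IsExp X g}) (fun _ ⟨_, _, h⟩ => h.1) he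

theorem isExp_zero : Q.IsExp 0 (OpenPartialHomeomorph.refl (Ambient n k)) :=
  ⟨.refl, Set.univ, 0, analyticAt_const, isOpen_univ, isConnected_univ, trivial,
    fun _ _ => analyticAt_const, fun _ _ _ _ => map_zero _, rfl, fun p _ =>
    ⟨fun _ => p, rfl, rfl, fun t _ => ⟨trivial, hasDerivWithinAt_const t _ p⟩⟩⟩

theorem refl_mem_expGroup {A : Set (HolField (Ambient n k))} (hA : 0 ∈ A) :
    OpenPartialHomeomorph.refl (Ambient n k) ∈ Q.expGroup A :=
  .of _ ⟨0, hA, Q.isExp_zero⟩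

theorem sHol_of_mem_expGroup {e : OpenPartialHomeomorph (Ambient n k) (Ambient n k)}
    (he : e ∈ Q.expGroup (Q.autS ψ)) : SHol ψ e := by
  change LocalGroupGen _ e at he
  induction he with
  | of e he =>
    obtain ⟨X, hX, he⟩ := he
    exact he.sHol hX
  | mul e₁ e₂ g _ he₂ h hS₁ hS₂ => exact h.sHol (Q.isLocalBihol_of_mem_expGroup he₂) hS₁ hS₂
  | inv e he h hS => exact (Q.isLocalBihol_of_mem_expGroup he).sHol_symm hS h

variable (ψ)

theorem zero_mem_autS : (0 : HolField (Ambient n k)) ∈ Q.autS ψ :=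
  (Q.autSLieSubalgebra ψ).zero_mem

theorem isLocalSubgroup_AutS : IsLocalSubgroup (Q.AutS ψ) Q.Aut where
  subset _ he := he.1
  one_mem := ⟨Q.refl_mem_expGroup Q.autLieSubalgebra.zero_mem,
    Q.isExp_zero.sHol (Q.zero_mem_autS ψ)⟩
  mul_mem e₁ h₁ e₂ h₂ g h := ⟨.mul e₁ e₂ g h₁.1 h₂.1 h,
    h.sHol (Q.isLocalBihol_of_mem_expGroup h₂.1) h₁.2 h₂.2⟩
  inv_mem e he h := ⟨.inv e he.1 h, (Q.isLocalBihol_of_mem_expGroup he.1).sHol_symm he.2 h⟩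

theorem isLocalSubgroup_expGroup_autS :
    IsLocalSubgroup (Q.expGroup (Q.autS ψ)) (Q.AutS ψ) where
  subset _ he :=
    ⟨LocalGroupGen.mono (G := {g | ∃ X ∈ Q.autS ψ, Q.IsExp X g})
      (H := {g | ∃ X ∈ Q.aut, Q.IsExp X g})
      (fun _ ⟨X, hX, h⟩ => ⟨X, hX.1, h⟩) he, Q.sHol_of_mem_expGroup he⟩
  one_mem := Q.refl_mem_expGroup (Q.zero_mem_autS ψ)
  mul_mem e₁ h₁ e₂ h₂ g h := .mul e₁ e₂ g h₁ h₂ h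
  inv_mem e he h := .inv e he h

end ModelSurface

end SHolGroups

/-! ### Superposition operators -/

section Topological

variable {K E F : Type*} [TopologicalSpace K] [TopologicalSpace E] [TopologicalSpace F]

theorem update_eval {ι : Type*} [DecidableEq ι] (u : ι → C(K, E)) (i : ι) (z : C(K, E))
    (t : K) :
    (fun j => Function.update u i z j t) = Function.update (fun j => u j t) i (z t) :=
  Function.comp_update (fun w : C(K, E) => w t) u i z

theorem eventually_forall_apply [CompactSpace K] {P : E → Prop} {u : C(K, E)}
    (hP : ∀ t, ∀ᶠ x in 𝓝 (u t), P x) : ∀ᶠ v in 𝓝 u, ∀ t, P (v t) := by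
  have hmaps : Set.MapsTo u Set.univ (interior {x | P x}) := fun t _ =>
    mem_interior_iff_mem_nhds.2 (hP t)
  filter_upwards [ContinuousMap.eventually_mapsTo isCompact_univ isOpen_interior hmaps]
    with v hv t
  exact interior_subset (hv (Set.mem_univ t))

theorem eventually_const_mem {x₀ : E} {s : Set C(K, E)}
    (hs : s ∈ 𝓝 (ContinuousMap.const K x₀)) : ∀ᶠ x in 𝓝 x₀, ContinuousMap.const K x ∈ s :=
  ContinuousMap.continuous_const'.continuousAt.eventually_mem hs

open Classical in
/-- The superposition operator `u ↦ f ∘ u` on spaces of continuous functions, with value zero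
where `f ∘ u` is discontinuous. -/
def superposition [Zero F] (f : E → F) (u : C(K, E)) : C(K, F) :=
  if h : Continuous (f ∘ u) then ⟨f ∘ u, h⟩ else 0

variable [Zero F] {f : E → F}

theorem superposition_apply {u : C(K, E)} (hf : ∀ t, ContinuousAt f (u t)) (t : K) :
    superposition f u t = f (u t) := by
  have h : Continuous (f ∘ u) := continuous_iff_continuousAt.2 fun t =>
    (hf t).comp u.continuous.continuousAt
  rw [superposition, dif_pos h]
  rfl

variable (f) in
@[simp]
theorem superposition_const (x : E) :
    superposition f (ContinuousMap.const K x) = ContinuousMap.const K (f x) :=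
  dif_pos (continuous_const (y := f x))

end Topological

section ConstCLM

variable (𝕜 K E : Type*) [NontriviallyNormedField 𝕜] [TopologicalSpace K]
  [NormedAddCommGroup E] [NormedSpace 𝕜 E]

/-- The embedding of a space as constant functions. -/
def constCLM : E →L[𝕜] C(K, E) where
  toFun := ContinuousMap.const K
  map_add' _ _ := rfl
  map_smul' _ _ := rfl
  cont := ContinuousMap.continuous_const'

end ConstCLM

section Superposition

variable {𝕜 K E F : Type*} [NontriviallyNormedField 𝕜] [TopologicalSpace K] [CompactSpace K]
  [NormedAddCommGroup E] [NormedSpace 𝕜 E] [NormedAddCommGroup F] [NormedSpace 𝕜 F]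

/-- A multilinear map applied pointwise to continuous functions. -/
def pointwiseMultilinear {n : ℕ} (p : ContinuousMultilinearMap 𝕜 (fun _ : Fin n => E) F) :
    ContinuousMultilinearMap 𝕜 (fun _ : Fin n => C(K, E)) C(K, F) :=
  MultilinearMap.mkContinuous
    { toFun := fun u => ⟨fun t => p fun j => u j t, by fun_prop⟩
      map_update_add' := fun u i x y => by ext t; simp [update_eval]
      map_update_smul' := fun u i c x => by ext t; simp [update_eval] }
    ‖p‖ fun u => (ContinuousMap.norm_le _ (by positivity)).2 fun t =>
      (p.le_opNorm _).trans (by gcongr with j; exact (u j).norm_coe_le_norm t)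

theorem norm_pointwiseMultilinear_le {n : ℕ}
    (p : ContinuousMultilinearMap 𝕜 (fun _ : Fin n => E) F) :
    ‖(pointwiseMultilinear p : ContinuousMultilinearMap 𝕜 (fun _ : Fin n => C(K, E)) _)‖ ≤ ‖p‖ :=
  MultilinearMap.mkContinuous_norm_le _ (norm_nonneg _) _

theorem analyticAt_superposition [CompleteSpace F] {f : E → F} {x : E} (hf : AnalyticAt 𝕜 f x) :
    AnalyticAt 𝕜 (superposition f) (ContinuousMap.const K x) := by
  obtain ⟨p, r, hp⟩ := hf
  let P : FormalMultilinearSeries 𝕜 C(K, E) C(K, F) := fun n => pointwiseMultilinear (p n)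
  have hr : r ≤ P.radius := hp.r_le.trans
    (FormalMultilinearSeries.radius_le_of_le fun n => norm_pointwiseMultilinear_le (p n))
  refine ⟨P, r, hr, hp.r_pos, fun {u} hu => ?_⟩
  have hut (t : K) : u t ∈ Metric.eball 0 r := by
    rw [mem_eball_zero_iff] at hu ⊢
    exact (enorm_le_iff_norm_le.2 (u.norm_coe_le_norm t)).trans_lt hu
  have hcont (t : K) : ContinuousAt f (x + u t) :=
    (hp.analyticAt_of_mem (by simpa [edist_eq_enorm_sub] using hut t)).continuousAt
  suffices hsum : P.sum u = superposition f (ContinuousMap.const K x + u) from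
    hsum ▸ P.hasSum (Metric.eball_subset_eball hr hu)
  ext t
  rw [superposition_apply hcont]
  exact ((ContinuousMap.evalCLM 𝕜 t).hasSum (P.hasSum (Metric.eball_subset_eball hr hu))).unique
    (hp.hasSum (hut t))

theorem fderiv_superposition_apply [CompleteSpace F] {f : E → F} {u : C(K, E)}
    (hs : DifferentiableAt 𝕜 (superposition f) u) (hf : ∀ t, AnalyticAt 𝕜 f (u t)) (w : C(K, E))
    (t : K) : fderiv 𝕜 (superposition f) u w t = fderiv 𝕜 f (u t) (w t) := by
  have heval := (ContinuousMap.evalCLM 𝕜 (M := F) t).hasFDerivAt.comp u hs.hasFDerivAt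
  have hcomp : HasFDerivAt (fun v : C(K, E) => f (v t)) _ u :=
    HasFDerivAt.comp (g := f) u (hf t).differentiableAt.hasFDerivAt
      (ContinuousMap.evalCLM 𝕜 (M := E) t).hasFDerivAt
  have happly : (fun v => superposition f v t) =ᶠ[𝓝 u] fun v => f (v t) := by
    filter_upwards [eventually_forall_apply fun t => (hf t).eventually_analyticAt] with v hv
    exact superposition_apply (fun t => (hv t).continuousAt) t
  exact DFunLike.congr_fun (heval.unique (hcomp.congr_of_eventuallyEq happly)) w

theorem IntertwinesAt.superposition [CompleteSpace F] {A : E →L[𝕜] E} {B : F →L[𝕜] F} {f : E → F}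
    {x : E} (hf : IntertwinesAt A B f x) :
    IntertwinesAt (A.compLeftContinuous 𝕜 K) (B.compLeftContinuous 𝕜 K)
      (CRAlg.superposition f) (ContinuousMap.const K x) := by
  have hs := analyticAt_superposition (K := K) hf.analyticAt
  refine ⟨hs, ?_⟩
  filter_upwards [hs.eventually_analyticAt, eventually_forall_apply (u := ContinuousMap.const K x)
    fun _ => hf.eventually] with u hsu hfu w
  ext t
  have hd := fderiv_superposition_apply hsu.differentiableAt fun t => (hfu t).analyticAt
  calc fderiv 𝕜 (CRAlg.superposition f) u (A.compLeftContinuous 𝕜 K w) t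
      = fderiv 𝕜 f (u t) (A (w t)) := hd _ t
    _ = B (fderiv 𝕜 f (u t) (w t)) := (hfu t).self_comm _
    _ = B.compLeftContinuous 𝕜 K (fderiv 𝕜 (CRAlg.superposition f) u w) t :=
      congrArg B (hd w t).symm

end Superposition

/-! ### Analytic flows near a zero of the field -/

section Curve

open Set

variable {E : Type*} [TopologicalSpace E]

/-- The space of continuous curves, parametrized by the unit interval. -/
abbrev Curve (E : Type*) [TopologicalSpace E] : Type _ := C(Icc (0 : ℝ) 1, E)

/-- A curve extended by constants to the whole line. -/
def Curve.extend (u : Curve E) : ℝ → E := IccExtend zero_le_one u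

theorem Curve.continuous_extend (u : Curve E) : Continuous u.extend :=
  u.continuous.Icc_extend'

theorem Curve.extend_coe (u : Curve E) (t : Icc (0 : ℝ) 1) : u.extend t = u t :=
  IccExtend_val zero_le_one u t

end Curve

section AnalyticFlow

open Set intervalIntegral

variable {E : Type*} [NormedAddCommGroup E] [NormedSpace ℂ E]

variable (E) in
/-- The operator `u ↦ ∫₀ᵗ u` on curves. -/
def primitive : Curve E →L[ℂ] Curve E :=
  LinearMap.mkContinuous
    { toFun := fun u => ⟨fun t => ∫ s in (0 : ℝ)..t, u.extend s,
        (continuous_primitive (fun _ _ => u.continuous_extend.intervalIntegrable _ _) 0).comp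
          continuous_subtype_val⟩
      map_add' := fun u v => by
        ext t
        exact integral_add (u.continuous_extend.intervalIntegrable _ _)
          (v.continuous_extend.intervalIntegrable _ _)
      map_smul' := fun c u => by
        ext t
        exact integral_smul c u.extend } 1
    (fun u => by
      refine (ContinuousMap.norm_le _ (by positivity)).2 fun t => ?_
      refine (norm_integral_le_of_norm_le_const fun s _ => u.norm_coe_le_norm _).trans ?_
      rw [sub_zero, abs_of_nonneg t.2.1, one_mul]
      exact mul_le_of_le_one_right (norm_nonneg _) t.2.2)

theorem primitive_compLeftContinuous [CompleteSpace E] (A : E →L[ℂ] E) (u : Curve E) :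
    primitive E (A.compLeftContinuous ℂ _ u) = A.compLeftContinuous ℂ _ (primitive E u) := by
  ext t
  exact A.intervalIntegral_comp_comm (u.continuous_extend.intervalIntegrable _ _)

theorem exists_hasDerivAt_primitive [CompleteSpace E] (u : Curve E) :
    ∃ y : ℝ → E, (∀ t : Icc (0 : ℝ) 1, y t = primitive E u t) ∧
      ∀ t : Icc (0 : ℝ) 1, HasDerivAt y (u t) t := by
  refine ⟨fun t => ∫ s in (0 : ℝ)..t, u.extend s, fun t => rfl, fun t => ?_⟩
  rw [← u.extend_coe]
  exact (u.continuous_extend.integral_hasStrictDerivAt 0 t).hasDerivAt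

theorem primitive_eq_sub [CompleteSpace E] {u : Curve E} {q : ℝ → E}
    (hq : ∀ t : Icc (0 : ℝ) 1, HasDerivAt q (u t) t) (t : Icc (0 : ℝ) 1) :
    primitive E u t = q t - q 0 := by
  have hderiv (s : ℝ) (hs : s ∈ Icc 0 (t : ℝ)) : HasDerivAt q (u.extend s) s := by
    have := hq ⟨s, hs.1, hs.2.trans t.2.2⟩
    rwa [← u.extend_coe] at this
  exact integral_eq_sub_of_hasDerivAt_of_le t.2.1
    (fun s hs => (hderiv s hs).continuousAt.continuousWithinAt)
    (fun s hs => hderiv s (Ioo_subset_Icc_self hs)) (u.continuous_extend.intervalIntegrable _ _)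

/-- The operator `u ↦ u - ∫ f(u)`; its value at `u` is the constant curve `x` if and only if `u`
solves the equation `u' = f(u)` with the initial value `x`. -/
def solutionDefect (f : E → E) (u : Curve E) : Curve E := u - primitive E (superposition f u)

theorem IntertwinesAt.solutionDefect [CompleteSpace E] {A : E →L[ℂ] E} {f : E → E} {x : E}
    (hf : IntertwinesAt A A f x) :
    IntertwinesAt (A.compLeftContinuous ℂ _) (A.compLeftContinuous ℂ _)
      (CRAlg.solutionDefect f) (ContinuousMap.const _ x) :=
  (IntertwinesAt.id _).sub
    (hf.superposition.clm_comp (primitive E) fun u => primitive_compLeftContinuous A u)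

variable {f g : E → E} {x₀ : E}

theorem analyticAt_solutionDefect [CompleteSpace E] (hf : AnalyticAt ℂ f x₀) :
    AnalyticAt ℂ (solutionDefect f) (ContinuousMap.const _ x₀) :=
  analyticAt_id.sub (((primitive E).analyticAt _).comp (analyticAt_superposition hf))

theorem fderiv_solutionDefect {u : Curve E} (hs : DifferentiableAt ℂ (superposition f) u) :
    fderiv ℂ (solutionDefect f) u = 1 - primitive E * fderiv ℂ (superposition f) u :=
  ((hasFDerivAt_id u).sub ((primitive E).hasFDerivAt.comp u hs.hasFDerivAt)).fderiv

theorem compLeftContinuous_pow_apply (A : E →L[ℂ] E) (n : ℕ) (u : Curve E) (t : Icc (0 : ℝ) 1) :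
    (A.compLeftContinuous ℂ (Icc (0 : ℝ) 1) ^ n) u t = (A ^ n) (u t) := by
  induction n generalizing u with
  | zero => rfl
  | succ n ih => rw [pow_succ, pow_succ]; exact ih _

theorem isUnit_fderiv_solutionDefect [CompleteSpace E] (hf : AnalyticAt ℂ f x₀)
    (hnil : IsNilpotent (fderiv ℂ f x₀)) :
    IsUnit (fderiv ℂ (solutionDefect f) (ContinuousMap.const _ x₀)) := by
  have hs : AnalyticAt ℂ (superposition f) (ContinuousMap.const (Icc (0 : ℝ) 1) x₀) :=
    analyticAt_superposition hf
  set L := (fderiv ℂ f x₀).compLeftContinuous ℂ (Icc (0 : ℝ) 1)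
  have hL : fderiv ℂ (superposition f) (ContinuousMap.const _ x₀) = L := by
    ext u t
    exact fderiv_superposition_apply hs.differentiableAt (fun _ => hf) u t
  have hcomm : Commute (primitive E) L :=
    ContinuousLinearMap.ext fun u => primitive_compLeftContinuous _ u
  have hLnil : IsNilpotent L := by
    obtain ⟨n, hn⟩ := hnil
    refine ⟨n, ?_⟩
    ext u t
    rw [compLeftContinuous_pow_apply, hn]
    rfl
  rw [fderiv_solutionDefect hs.differentiableAt, hL]
  exact (hcomm.isNilpotent_mul_left hLnil).isUnit_one_sub

/-- `e` inverts `solutionDefect f` near the constant curve at the zero `x₀` of `f`, so that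
`e.symm` solves the equation `u' = f(u)` for initial values near `x₀`. -/
structure IsSolutionChart (f : E → E) (x₀ : E) (e : OpenPartialHomeomorph (Curve E) (Curve E)) :
    Prop where
  analyticAt : AnalyticAt ℂ f x₀
  eq_zero : f x₀ = 0
  coe_eq : ⇑e = solutionDefect f
  mem_source : ContinuousMap.const _ x₀ ∈ e.source
  analyticAt_symm : AnalyticAt ℂ e.symm (ContinuousMap.const _ x₀)

theorem solutionDefect_const {x : E} (hx : f x = 0) :
    solutionDefect f (ContinuousMap.const _ x) = ContinuousMap.const _ x := by
  have hconst : ContinuousMap.const (Icc (0 : ℝ) 1) (0 : E) = 0 := rfl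
  rw [solutionDefect, superposition_const, hx, hconst, map_zero, sub_zero]

theorem exists_isSolutionChart [CompleteSpace E] (hf : AnalyticAt ℂ f x₀) (hf₀ : f x₀ = 0)
    (hnil : IsNilpotent (fderiv ℂ f x₀)) : ∃ e, IsSolutionChart f x₀ e := by
  have hd := analyticAt_solutionDefect hf
  obtain ⟨I, hI⟩ := isUnit_fderiv_solutionDefect hf hnil
  let I' : Curve E ≃L[ℂ] Curve E := ContinuousLinearEquiv.unitsEquiv ℂ _ I
  have hI' : (I' : Curve E →L[ℂ] Curve E) = _ := hI
  have hstrict : HasStrictFDerivAt (solutionDefect f) (I' : Curve E →L[ℂ] Curve E)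
      (ContinuousMap.const _ x₀) := hI' ▸ hd.hasStrictFDerivAt
  let e := hstrict.toOpenPartialHomeomorph (solutionDefect f)
  have he : ⇑e = solutionDefect f := hstrict.toOpenPartialHomeomorph_coe
  have hsource := hstrict.mem_toOpenPartialHomeomorph_source
  refine ⟨e, hf, hf₀, he, hsource, ?_⟩
  rw [← solutionDefect_const hf₀, ← he]
  exact e.analyticAt_symm' (i := I') hsource (he ▸ hd) (by rw [he, hI'])

/-- The solution of the equation with the initial value `x`. -/
def solution (e : OpenPartialHomeomorph (Curve E) (Curve E)) (x : E) : Curve E :=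
  e.symm (ContinuousMap.const _ x)

namespace IsSolutionChart

variable {e : OpenPartialHomeomorph (Curve E) (Curve E)}

theorem const_mem_target (h : IsSolutionChart f x₀ e) : ContinuousMap.const _ x₀ ∈ e.target := by
  rw [← solutionDefect_const h.eq_zero, ← h.coe_eq]
  exact e.map_source h.mem_source

theorem eventually_solution_eq_const (h : IsSolutionChart f x₀ e) :
    ∀ᶠ x in 𝓝 x₀, f x = 0 → solution e x = ContinuousMap.const _ x := by
  filter_upwards [eventually_const_mem (e.open_source.mem_nhds h.mem_source)] with x hx hfx
  have he : e (ContinuousMap.const _ x) = ContinuousMap.const _ x := by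
    rw [h.coe_eq, solutionDefect_const hfx]
  rw [solution, ← he, e.left_inv hx, he]

theorem analyticAt_solution (h : IsSolutionChart f x₀ e) : AnalyticAt ℂ (solution e) x₀ :=
  AnalyticAt.comp (f := constCLM ℂ (Icc (0 : ℝ) 1) E) h.analyticAt_symm
    ((constCLM ℂ (Icc (0 : ℝ) 1) E).analyticAt x₀)

theorem tendsto_solution (h : IsSolutionChart f x₀ e) :
    Filter.Tendsto (solution e) (𝓝 x₀) (𝓝 (ContinuousMap.const _ x₀)) := by
  have := h.analyticAt_solution.continuousAt.tendsto
  rwa [h.eventually_solution_eq_const.self_of_nhds h.eq_zero] at this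

theorem eventually_solution_eq (h : IsSolutionChart f x₀ e) :
    ∀ᶠ x in 𝓝 x₀, solution e x =
      ContinuousMap.const _ x + primitive E (superposition f (solution e x)) := by
  filter_upwards [eventually_const_mem (e.open_target.mem_nhds h.const_mem_target)] with x hx
  have := e.right_inv hx
  rwa [h.coe_eq, solutionDefect, sub_eq_iff_eq_add] at this

theorem intertwinesAt_solution [CompleteSpace E] (h : IsSolutionChart f x₀ e) {A : E →L[ℂ] E}
    (hf : IntertwinesAt A A f x₀) :
    IntertwinesAt A (A.compLeftContinuous ℂ _) (solution e) x₀ := by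
  have hsymm : e.symm (ContinuousMap.const _ x₀) = ContinuousMap.const _ x₀ :=
    h.eventually_solution_eq_const.self_of_nhds h.eq_zero
  have he : IntertwinesAt (A.compLeftContinuous ℂ _) (A.compLeftContinuous ℂ _) e
      (e.symm (ContinuousMap.const _ x₀)) := by
    rw [h.coe_eq, hsymm]
    exact hf.solutionDefect
  have hconst : IntertwinesAt A (A.compLeftContinuous ℂ _) (constCLM ℂ (Icc (0 : ℝ) 1) E) x₀ :=
    .of_clm (constCLM ℂ (Icc (0 : ℝ) 1) E) (fun _ => rfl) x₀
  exact (he.symm h.const_mem_target h.analyticAt_symm).comp (f := constCLM ℂ _ E) hconst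

end IsSolutionChart

theorem hasDerivAt_smul_of_lieBracket_eq_zero {y : ℝ → E} {t : ℝ} {v : E}
    (hy : HasDerivAt y (f (y t)) t) (hg : DifferentiableAt ℂ g (y t))
    (hv : fderiv ℂ f (y t) v = g (y t)) (hfg : VectorField.lieBracket ℂ f g (y t) = 0) :
    HasDerivAt (fun s => s • g (y s)) (fderiv ℂ f (y t) (v + t • g (y t))) t := by
  have hgy : HasDerivAt (fun s => g (y s)) (fderiv ℂ g (y t) (f (y t))) t :=
    (hg.hasFDerivAt.restrictScalars ℝ).comp_hasDerivAt t hy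
  rw [sub_eq_zero.1 hfg] at hgy
  refine ((hasDerivAt_id t).smul hgy).congr_deriv ?_
  rw [map_add, hv, ContinuousLinearMap.map_smul_of_tower, one_smul, add_comm]
  rfl

theorem primitive_eq_smul_of_lieBracket_eq_zero [CompleteSpace E] {u w : Curve E} {x v : E}
    (hu : u = ContinuousMap.const _ x + primitive E (superposition f u))
    (hf : ∀ t, ContinuousAt f (u t)) (hg : ∀ t, DifferentiableAt ℂ g (u t))
    (hv : ∀ t, fderiv ℂ f (u t) v = g (u t)) (hfg : ∀ t, VectorField.lieBracket ℂ f g (u t) = 0)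
    (hw : ∀ t, w t = fderiv ℂ f (u t) (v + (t : ℝ) • g (u t))) (t : Icc (0 : ℝ) 1) :
    primitive E w t = (t : ℝ) • g (u t) := by
  obtain ⟨y, hy, hyd⟩ := exists_hasDerivAt_primitive (superposition f u)
  have hxy (t : Icc (0 : ℝ) 1) : x + y t = u t := by
    rw [hy]
    exact (DFunLike.congr_fun hu t).symm
  have hderiv (t : Icc (0 : ℝ) 1) : HasDerivAt (fun s : ℝ => s • g (x + y s)) (w t) t := by
    rw [hw, ← hxy]
    apply hasDerivAt_smul_of_lieBracket_eq_zero (y := fun s => x + y s) <;> simp only [hxy]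
    · exact superposition_apply hf t ▸ (hyd t).const_add x
    · exact hg t
    · exact hv t
    · exact hfg t
  rw [primitive_eq_sub hderiv, zero_smul, sub_zero, hxy]

/-- If the field `g = ∂f/∂v` commutes with `f`, then `v + t g(u(t))` solves the variational equation
along the solution `u`. -/
theorem IsSolutionChart.fderiv_solution_apply [CompleteSpace E]
    {e : OpenPartialHomeomorph (Curve E) (Curve E)} (h : IsSolutionChart f x₀ e) {v : E}
    (hg : AnalyticAt ℂ g x₀) (hv : ∀ᶠ x in 𝓝 x₀, fderiv ℂ f x v = g x)
    (hfg : ∀ᶠ x in 𝓝 x₀, VectorField.lieBracket ℂ f g x = 0) :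
    ∀ᶠ x in 𝓝 x₀, ∀ t : Icc (0 : ℝ) 1,
      fderiv ℂ (solution e) x v t = v + (t : ℝ) • g (solution e x t) := by
  have along {P : E → Prop} (hP : ∀ᶠ y in 𝓝 x₀, P y) :
      ∀ᶠ x in 𝓝 x₀, ∀ t, P (solution e x t) :=
    h.tendsto_solution.eventually (eventually_forall_apply fun _ => hP)
  filter_upwards [h.eventually_solution_eq, along h.analyticAt.eventually_analyticAt,
    along hg.eventually_analyticAt, along hv, along hfg,
    h.tendsto_solution.eventually (analyticAt_superposition h.analyticAt).eventually_analyticAt,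
    h.tendsto_solution.eventually (analyticAt_solutionDefect h.analyticAt).eventually_analyticAt,
    eventually_const_mem (e.open_target.mem_nhds h.const_mem_target),
    eventually_const_mem h.analyticAt_symm.eventually_analyticAt]
    with x hx hfx hgx hvx hfgx hs hd htarget hsymm
  set u := solution e x with hu
  let w : Curve E := ⟨fun t => v + (t : ℝ) • superposition g u t, by fun_prop⟩
  have hw (t) : w t = v + (t : ℝ) • g (u t) :=
    congrArg (fun z => v + (t : ℝ) • z) (superposition_apply (fun t => (hgx t).continuousAt) t)
  have hdefect : fderiv ℂ e u w = ContinuousMap.const _ v := by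
    ext t
    have := primitive_eq_smul_of_lieBracket_eq_zero (w := fderiv ℂ (superposition f) u w) hx
      (fun t => (hfx t).continuousAt) (fun t => (hgx t).differentiableAt) hvx hfgx
      (fun t => by rw [fderiv_superposition_apply hs.differentiableAt hfx, hw]) t
    rw [h.coe_eq, fderiv_solutionDefect hs.differentiableAt]
    change w t - primitive E (fderiv ℂ (superposition f) u w) t = v
    rw [this, hw, add_sub_cancel_right]
  have hsolution : fderiv ℂ (solution e) x v =
      fderiv ℂ e.symm (ContinuousMap.const _ x) (ContinuousMap.const _ v) :=
    DFunLike.congr_fun (hsymm.differentiableAt.hasFDerivAt.comp x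
      (constCLM ℂ (Icc (0 : ℝ) 1) E).hasFDerivAt).fderiv v
  intro t
  rw [hsolution, ← hdefect, hu, solution, fderiv_symm_apply_fderiv htarget
    (h.coe_eq ▸ hd.differentiableAt) hsymm.differentiableAt, hw]
  rfl

end AnalyticFlow

/-! ### Equations with time in the algebra -/

section AlgebraicTime

variable {S : Type*} [CommRing S] [Algebra ℝ S] [FiniteDimensional ℝ S] {N : ℕ}

variable (S N) in
/-- The first of `N + 1` algebraic variables (the time) and the remaining ones. -/
def headTail :
    (Fin (N + 1) → Complexification S) →L[ℂ] Complexification S × (Fin N → Complexification S) :=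
  (ContinuousLinearMap.proj 0).prod
    (ContinuousLinearMap.pi fun i => ContinuousLinearMap.proj (Fin.succ i))

/-- The multiplication by an element of the algebra on the product of the time and space
variables. -/
def prodAction (N : ℕ) (a : Complexification S) :
    Complexification S × (Fin N → Complexification S) →L[ℂ]
      Complexification S × (Fin N → Complexification S) :=
  (LinearMap.mulLeft ℂ a).toContinuousLinearMap.prodMap (smulCLM N a)

theorem prodAction_apply (a : Complexification S)
    (x : Complexification S × (Fin N → Complexification S)) :
    prodAction N a x = (a * x.1, a • x.2) := rfl

/-- The field `(T, Z) ↦ (0, F(Z))` on the product of the time and space variables. -/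
def spaceField (F : (Fin N → Complexification S) → (Fin N → Complexification S))
    (x : Complexification S × (Fin N → Complexification S)) :
    Complexification S × (Fin N → Complexification S) := (0, F x.2)

/-- The field `(T, Z) ↦ (0, T F(Z))`, whose flow at the real time one moves `Z` along the
equation with the right-hand side `F` by the algebraic time `T`. -/
def suspension (F : (Fin N → Complexification S) → (Fin N → Complexification S))
    (x : Complexification S × (Fin N → Complexification S)) :
    Complexification S × (Fin N → Complexification S) := (0, x.1 • F x.2)

variable {F : (Fin N → Complexification S) → (Fin N → Complexification S)}
  {x : Complexification S × (Fin N → Complexification S)}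

theorem analyticAt_spaceField (hF : AnalyticAt ℂ F x.2) : AnalyticAt ℂ (spaceField F) x :=
  analyticAt_const.prod (AnalyticAt.comp (f := Prod.snd) hF analyticAt_snd)

theorem analyticAt_suspension (hF : AnalyticAt ℂ F x.2) : AnalyticAt ℂ (suspension F) x :=
  analyticAt_const.prod (((smulCLM N).analyticAt_bilinear _).comp₂ analyticAt_fst
    (AnalyticAt.comp (f := Prod.snd) hF analyticAt_snd))

theorem fderiv_spaceField (hF : DifferentiableAt ℂ F x.2)
    (h : Complexification S × (Fin N → Complexification S)) :
    fderiv ℂ (spaceField F) x h = (0, fderiv ℂ F x.2 h.2) :=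
  DFunLike.congr_fun ((hasFDerivAt_const 0 x).prodMk
    (HasFDerivAt.comp (f := Prod.snd) x hF.hasFDerivAt hasFDerivAt_snd)).fderiv h

theorem fderiv_suspension (hF : DifferentiableAt ℂ F x.2)
    (h : Complexification S × (Fin N → Complexification S)) :
    fderiv ℂ (suspension F) x h = (0, h.1 • F x.2 + x.1 • fderiv ℂ F x.2 h.2) := by
  have hsnd : HasFDerivAt (fun y : Complexification S × (Fin N → Complexification S) => F y.2)
      ((fderiv ℂ F x.2).comp (ContinuousLinearMap.snd ℂ _ _)) x :=
    HasFDerivAt.comp (f := Prod.snd) x hF.hasFDerivAt hasFDerivAt_snd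
  have hsmul := (HasFDerivAt.comp (f := Prod.fst) x (smulCLM (S := S) N).hasFDerivAt
    hasFDerivAt_fst).clm_apply hsnd
  refine (DFunLike.congr_fun ((hasFDerivAt_const 0 x).prodMk hsmul).fderiv h).trans ?_
  exact congrArg (Prod.mk 0) (add_comm _ _)

theorem intertwinesAt_suspension {a : Complexification S}
    (hF : IntertwinesAt (smulCLM N a) (smulCLM N a) F x.2) :
    IntertwinesAt (prodAction N a) (prodAction N a) (suspension F) x := by
  refine ⟨analyticAt_suspension hF.analyticAt, ?_⟩
  filter_upwards [continuous_snd.continuousAt.eventually hF.eventually] with y hy h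
  have hd := hy.analyticAt.differentiableAt
  have hcomm : fderiv ℂ F y.2 (a • h.2) = a • fderiv ℂ F y.2 h.2 := hy.self_comm h.2
  rw [fderiv_suspension hd, fderiv_suspension hd]
  simp only [prodAction_apply, hcomm, mul_zero, smul_add, mul_smul, smul_comm y.1 a]

theorem isNilpotent_fderiv_suspension (hF : DifferentiableAt ℂ F 0) :
    IsNilpotent (fderiv ℂ (suspension F) 0) := by
  refine ⟨2, ContinuousLinearMap.ext fun h => ?_⟩
  rw [pow_two, mul_apply_eq_comp, fderiv_suspension hF, fderiv_suspension hF]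
  simp

theorem lieBracket_suspension_spaceField (hF : DifferentiableAt ℂ F x.2)
    (hcomm : ∀ (a : Complexification S) h, fderiv ℂ F x.2 (a • h) = a • fderiv ℂ F x.2 h) :
    VectorField.lieBracket ℂ (suspension F) (spaceField F) x = 0 := by
  rw [VectorField.lieBracket, fderiv_spaceField hF, fderiv_suspension hF]
  simp [suspension, spaceField, hcomm]

variable (S N) in
/-- The evaluation of the space component of a curve at the time one. -/
def spaceAtOne :
    Curve (Complexification S × (Fin N → Complexification S)) →L[ℂ] (Fin N → Complexification S) :=
  (ContinuousLinearMap.snd ℂ _ _).comp (ContinuousMap.evalCLM ℂ 1)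

/-- The flow `Ψ(T, Z)` in algebraic time read off from the solutions of the suspended equation. -/
def algebraicFlow
    (e : OpenPartialHomeomorph (Curve (Complexification S × (Fin N → Complexification S)))
      (Curve (Complexification S × (Fin N → Complexification S))))
    (p : Fin (N + 1) → Complexification S) : Fin N → Complexification S :=
  spaceAtOne S N (solution e (headTail S N p))

theorem algebraicFlow_cons
    (e : OpenPartialHomeomorph (Curve (Complexification S × (Fin N → Complexification S)))
      (Curve (Complexification S × (Fin N → Complexification S))))
    (T : Complexification S) (Z : Fin N → Complexification S) :
    algebraicFlow e (Fin.cons T Z) = (solution e (T, Z) 1).2 := rfl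

namespace IsSolutionChart

variable {e : OpenPartialHomeomorph (Curve (Complexification S × (Fin N → Complexification S)))
  (Curve (Complexification S × (Fin N → Complexification S)))}

theorem sHolomorphicNearZero_algebraicFlow (h : IsSolutionChart (suspension F) 0 e)
    (hF : SHolomorphicNearZero F) : SHolomorphicNearZero (algebraicFlow e) := by
  refine sAnalyticAt_iff.2 fun a => ?_
  have hsolution := h.intertwinesAt_solution
    (intertwinesAt_suspension (x := 0) (sAnalyticAt_iff.1 hF a))
  have hhead : IntertwinesAt (smulCLM (N + 1) a) (prodAction N a) (headTail S N) 0 :=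
    .of_clm (headTail S N) (fun _ => rfl) 0
  rw [← map_zero (headTail S N)] at hsolution
  exact (hsolution.clm_comp (C := smulCLM N a) (spaceAtOne S N) fun _ => rfl).comp
    (f := headTail S N) hhead

theorem eventually_algebraicFlow_zero_time (h : IsSolutionChart (suspension F) 0 e) :
    ∀ᶠ Z in 𝓝 (0 : Fin N → Complexification S), algebraicFlow e (Fin.cons 0 Z) = Z := by
  have htendsto : Filter.Tendsto (fun Z : Fin N → Complexification S =>
      ((0 : Complexification S), Z)) (𝓝 0) (𝓝 0) :=
    (Continuous.prodMk continuous_const continuous_id).tendsto 0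
  filter_upwards [htendsto.eventually h.eventually_solution_eq_const] with Z hZ
  rw [algebraicFlow_cons, hZ (by simp [suspension])]
  rfl

theorem eventually_hasDerivAt_algebraicFlow (h : IsSolutionChart (suspension F) 0 e)
    (hF : SHolomorphicNearZero F) :
    ∀ᶠ p in 𝓝 (0 : Complexification S × (Fin N → Complexification S)),
      HasDerivAt
        (fun s : ℂ => algebraicFlow e
          (Fin.cons (p.1 + algebraMap ℂ (Complexification S) s) p.2))
        (F (algebraicFlow e (Fin.cons p.1 p.2))) 0 := by
  have hsnd : Filter.Tendsto Prod.snd (𝓝 (0 : Complexification S × (Fin N → Complexification S)))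
      (𝓝 0) := continuous_snd.tendsto 0
  have hspace : ∀ᶠ x in 𝓝 (0 : Complexification S × (Fin N → Complexification S)),
      ∀ a, IntertwinesAt (smulCLM N a) (smulCLM N a) F x.2 :=
    (hsnd.eventually hF.eventually).mono fun _ hx => sAnalyticAt_iff.1 hx
  have hvariation := h.fderiv_solution_apply (g := spaceField F) (v := (1, 0))
    (analyticAt_spaceField (hspace.self_of_nhds 0).analyticAt)
    (hspace.mono fun x hx => by
      rw [fderiv_suspension (hx 0).analyticAt.differentiableAt]
      simp [spaceField])
    (hspace.mono fun x hx => lieBracket_suspension_spaceField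
      (hx 0).analyticAt.differentiableAt fun a => (hx a).self_comm)
  filter_upwards [hvariation, h.analyticAt_solution.eventually_analyticAt] with p hp hsolution
  have hline : HasDerivAt (fun s : ℂ => (p.1 + algebraMap ℂ (Complexification S) s, p.2))
      ((1 : Complexification S), (0 : Fin N → Complexification S)) 0 := by
    refine HasDerivAt.prodMk ?_ (hasDerivAt_const _ _)
    simp only [Algebra.algebraMap_eq_smul_one]
    simpa using ((hasDerivAt_id (0 : ℂ)).smul_const (1 : Complexification S)).const_add p.1
  have hp0 : p = (p.1 + algebraMap ℂ (Complexification S) 0, p.2) := by simp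
  have hderiv := (spaceAtOne S N).hasFDerivAt.comp_hasDerivAt 0
    ((hp0 ▸ hsolution.differentiableAt).hasFDerivAt.comp_hasDerivAt 0 hline)
  refine HasDerivAt.congr_deriv hderiv ?_
  rw [← hp0]
  change (fderiv ℂ (solution e) p (1, 0) 1).2 = F (solution e p 1).2
  rw [hp]
  simp [spaceField]

end IsSolutionChart

theorem exists_algebraic_flow (hF : SHolomorphicNearZero F) :
    ∃ Ψ : (Fin (N + 1) → Complexification S) → (Fin N → Complexification S),
      SHolomorphicNearZero Ψ ∧
      (∀ᶠ Z in 𝓝 (0 : Fin N → Complexification S), Ψ (Fin.cons 0 Z) = Z) ∧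
      ∀ᶠ p in 𝓝 (0 : Complexification S × (Fin N → Complexification S)),
        HasDerivAt
          (fun s : ℂ => Ψ (Fin.cons (p.1 + algebraMap ℂ (Complexification S) s) p.2))
          (F (Ψ (Fin.cons p.1 p.2))) 0 := by
  have hFa : AnalyticAt ℂ F 0 := (sAnalyticAt_iff.1 hF 0).analyticAt
  obtain ⟨e, he⟩ := exists_isSolutionChart (analyticAt_suspension (x := 0) hFa)
    (by simp [suspension]) (isNilpotent_fderiv_suspension hFa.differentiableAt)
  exact ⟨algebraicFlow e, he.sHolomorphicNearZero_algebraicFlow hF,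
    he.eventually_algebraicFlow_zero_time, he.eventually_hasDerivAt_algebraicFlow hF⟩

end AlgebraicTime

end CRAlg

end

theorem theorem4_general {S : Type*} [CommRing S] [Algebra ℝ S] [FiniteDimensional ℝ S] {n k N : ℕ}
    (Q : CRAlg.ModelSurface n k)
    (ψ : CRAlg.Ambient n k ≃ₗ[ℂ] (Fin N → CRAlg.Complexification S)) :
    (∃ A : LieSubalgebra ℝ (CRAlg.HolField (CRAlg.Ambient n k)),
      (A : Set (CRAlg.HolField (CRAlg.Ambient n k))) = Q.aut ∧
      ∃ B : LieSubalgebra ℝ A, ∀ X : A, X ∈ B ↔ (X : CRAlg.HolField _) ∈ Q.autS ψ) ∧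
    (CRAlg.IsLocalSubgroup (Q.AutS ψ) Q.Aut ∧
      CRAlg.IsLocalSubgroup (Q.expGroup (Q.autS ψ)) (Q.AutS ψ)) ∧
    (∀ F : (Fin N → CRAlg.Complexification S) → (Fin N → CRAlg.Complexification S),
      CRAlg.SHolomorphicNearZero F →
      ∃ Ψ : (Fin (N + 1) → CRAlg.Complexification S) → (Fin N → CRAlg.Complexification S),
        CRAlg.SHolomorphicNearZero Ψ ∧
        (∀ᶠ Z in 𝓝 (0 : Fin N → CRAlg.Complexification S), Ψ (Fin.cons 0 Z) = Z) ∧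
        ∀ᶠ p in 𝓝 (0 : CRAlg.Complexification S × (Fin N → CRAlg.Complexification S)),
          HasDerivAt
            (fun s : ℂ => Ψ (Fin.cons (p.1 + algebraMap ℂ (CRAlg.Complexification S) s) p.2))
            (F (Ψ (Fin.cons p.1 p.2))) 0) :=
  ⟨⟨Q.autLieSubalgebra, rfl, Q.autSLieSubalgebra ψ, fun _ => Iff.rfl⟩,
    ⟨Q.isLocalSubgroup_AutS ψ, Q.isLocalSubgroup_expGroup_autS ψ⟩,
    fun _ hF => CRAlg.exists_algebraic_flow hF⟩

theorem theorem4 {S : Type*} [CommRing S] [Algebra ℝ S] [FiniteDimensional ℝ S] {n k N : ℕ}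
    (Q : CRAlg.ModelSurface n k) (hQ : Q.Nondegenerate)
    (ψ : CRAlg.Ambient n k ≃ₗ[ℂ] (Fin N → CRAlg.Complexification S)) :
    -- (a) `aut Q` is a Lie algebra, and `aut_S Q` is a Lie subalgebra of it
    (∃ A : LieSubalgebra ℝ (CRAlg.HolField (CRAlg.Ambient n k)),
      (A : Set (CRAlg.HolField (CRAlg.Ambient n k))) = Q.aut ∧
      ∃ B : LieSubalgebra ℝ A, ∀ X : A, X ∈ B ↔ (X : CRAlg.HolField _) ∈ Q.autS ψ) ∧
    -- (b) `Aut_S Q` is a subgroup of the local group `Aut Q`, and the local group generated by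
    -- `exp (aut_S Q)` is a subgroup of `Aut_S Q`
    (CRAlg.IsLocalSubgroup (Q.AutS ψ) Q.Aut ∧
      CRAlg.IsLocalSubgroup (Q.expGroup (Q.autS ψ)) (Q.AutS ψ)) ∧
    -- the solution `Ψ(T, Z)` of an `S`-holomorphic equation `dζ/dt = F(ζ)`, `ζ(0) = Z`, is
    -- `S`-holomorphic in the time and the initial value
    (∀ F : (Fin N → CRAlg.Complexification S) → (Fin N → CRAlg.Complexification S),
      CRAlg.SHolomorphicNearZero F →
      ∃ Ψ : (Fin (N + 1) → CRAlg.Complexification S) → (Fin N → CRAlg.Complexification S),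
        CRAlg.SHolomorphicNearZero Ψ ∧
        (∀ᶠ Z in 𝓝 (0 : Fin N → CRAlg.Complexification S), Ψ (Fin.cons 0 Z) = Z) ∧
        ∀ᶠ p in 𝓝 (0 : CRAlg.Complexification S × (Fin N → CRAlg.Complexification S)),
          HasDerivAt
            (fun s : ℂ => Ψ (Fin.cons (p.1 + algebraMap ℂ (CRAlg.Complexification S) s) p.2))
            (F (Ψ (Fin.cons p.1 p.2))) 0) :=
  theorem4_general Q ψ
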